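/- Let $X=\prod_{i\ge 0}A_i$ and $Y=\prod_{i\ge 0}\tilde A_i$, where all $A_i,\tilde A_i$ are finite non-empty sets, with the product topologies and Borel $\sigma$-algebras; write $x_{(n)}=(x_n,x_{n+1},\dots)$. Let $\pi:X\to Y$ be a symbolic map, that is $\pi(x)_i=\pi_i(x_i)$ with surjections $\pi_i:A_i\to\tilde A_i$. Let $(\phi_n)_{n\ge 0}$ be a sequence of one-point potentials: each $\phi_n:X\to\mathbb R$ is continuous and depends on $x_{(n)}$ only. Put $$r_k=\sup_{n\ge 0}\ \sup\{|\phi_n(x)-\phi_n(x')| : x_i=x'_i \text{ for } n\le i<n+k\},$$ and assume Berbee's condition $\sum_{n\ge 1}e^{-r_1-\cdots-r_n}=\infty$. Let $\mu$ be a Gibbs measure for the potential $\phi=\sum_n\phi_n$, that is, a Borel probability measure on $X$ such that for every finite $\Lambda\subset\{0,1,2,\dots\}$ the conditional probability under $\mu$ of $x_\Lambda$ given $x_{\Lambda^c}$ is proportional to $\exp\big(\sum_{k<N}\phi_k(x)\big)$, where $\Lambda\subset[0,N)$. Then: (i) The conditional measure $\mu(\cdot\mid y)$ of $x$ given $\pi(x)=y$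 has a unique version that is defined for all $y\in Y$ and depends continuously on $y$, for the weak topology on the probability measures on $X$. (ii) If, in addition, $(\phi_n)$ is normalised, i.e. $\sum_{a\in A_n}e^{\phi_n(a,x_{(n+1)})}=1$ for all $n$ and $x$, then for each $n$ the conditional measure $\mu(\cdot\mid y_{(n)})$ of $x$ given $\pi(x)_{(n)}=y_{(n)}$ also has a unique continuous version. With these versions, the functions $$\tilde p_n(y)=\tilde p_n(y_{(n)})=\int\ \sum_{x_n\in\pi_n^{-1}(y_n)}e^{\phi_n(x_n,x_{(n+1)})}\,d\mu(x_{(n+1)}\mid y_{(n+1)})$$ are positive and continuous, $(\log\tilde p_n)_{n\ge0}$ is a normalised sequence of one-point potentials on $Y$, and $\tilde\mu=\mu\circ\pi^{-1}$ is a Gibbs measure for the potential $\sum_n\log\tilde p_n$. -/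

import Mathlib

open MeasureTheory ProbabilityTheory
open scoped ENNReal

namespace SymbolicFactor

/-- A sequence of one-point potentials `φ₀, φ₁, …` on the symbolic space `X = ∏ i, A i`: each `φ n`
is continuous on `X` and is a function of the tail `(x n, x (n+1), …)` only. -/
structure IsOnePointPotential {A : ℕ → Type*} [∀ i, TopologicalSpace (A i)]
    (φ : ℕ → (∀ i, A i) → ℝ) : Prop where
  continuous : ∀ n, Continuous (φ n)
  dependsOn : ∀ n, DependsOn (φ n) (Set.Ici n)

/-- `r k = sup_n var_k (φ n)`, where `var_k (φ n)` is the supremum of `|φ n x - φ n y|` over all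
`x, y` whose tails from `n` on coincide in their first `k` coordinates. It may be infinite. -/
noncomputable def uniformVariation {A : ℕ → Type*} (φ : ℕ → (∀ i, A i) → ℝ) (k : ℕ) : ℝ≥0∞ :=
  ⨆ (n : ℕ) (x : ∀ i, A i) (y : ∀ i, A i) (_ : ∀ i, n ≤ i → i < n + k → x i = y i),
    ENNReal.ofReal |φ n x - φ n y|

/-- Berbee's condition `∑_{n ≥ 1} exp (-r₁ - ⋯ - rₙ) = ∞`, with `exp (-∞) = 0`. -/
def BerbeeCondition {A : ℕ → Type*} (φ : ℕ → (∀ i, A i) → ℝ) : Prop :=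
  ∑' n : ℕ, EReal.exp
    (-((∑ k ∈ Finset.Icc 1 (n + 1), uniformVariation φ k : ℝ≥0∞) : EReal)) = ∞

/-- A representative of the potential `∑ₖ φ k` on the finite block `Λ`: the sum of the `φ k` over
all `k < N`, where `N` is the least number with `Λ ⊆ [0, N)`. If `x` and `y` coincide outside `Λ`,
the omitted terms do not contribute to the difference of the potential at `x` and `y`.
For `Λ = [0, n)` it is `φ₀ + ⋯ + φ_{n-1}`. -/
noncomputable def blockPotential {A : ℕ → Type*} (φ : ℕ → (∀ i, A i) → ℝ) (Λ : Finset ℕ)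
    (x : ∀ i, A i) : ℝ :=
  ∑ k ∈ Finset.range (Λ.sup (fun i => i + 1)), φ k x

/-- The local partition function: a sum over all ways to change `x` inside `Λ`. -/
noncomputable def partitionFunction {A : ℕ → Type*} [∀ i, Fintype (A i)]
    (φ : ℕ → (∀ i, A i) → ℝ) (Λ : Finset ℕ) (x : ∀ i, A i) : ℝ :=
  ∑ a : (∀ i : Λ, A i), Real.exp (blockPotential φ Λ (Function.updateFinset x Λ a))

/-- The conditional probability of `x` inside `Λ` given `x` outside `Λ`, prescribed by the
potential `∑ₖ φ k`. -/
noncomputable def specification {A : ℕ → Type*} [∀ i, Fintype (A i)]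
    (φ : ℕ → (∀ i, A i) → ℝ) (Λ : Finset ℕ) (x : ∀ i, A i) : ℝ :=
  Real.exp (blockPotential φ Λ x) / partitionFunction φ Λ x

/-- `μ` is a Gibbs measure for the potential `∑ₖ φ k`: for every finite `Λ` and continuous `f`,
`μ(f)` is the `μ`-mean over `x` outside `Λ` of the mean of `f` under the specification on `Λ`. -/
def IsGibbs {A : ℕ → Type*} [∀ i, Fintype (A i)] [∀ i, TopologicalSpace (A i)]
    [∀ i, MeasurableSpace (A i)] (φ : ℕ → (∀ i, A i) → ℝ) (μ : Measure (∀ i, A i)) : Prop :=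
  ∀ (Λ : Finset ℕ) (f : C((∀ i, A i), ℝ)),
    ∫ x, f x ∂μ =
      ∫ x, ∑ a : (∀ i : Λ, A i),
        f (Function.updateFinset x Λ a) *
          specification φ Λ (Function.updateFinset x Λ a) ∂μ

/-- The sequence is normalised: `∑_{a ∈ A n} exp (φ n (a, x (n+1), x (n+2), …)) = 1`. -/
def IsNormalised {A : ℕ → Type*} [∀ i, Fintype (A i)] (φ : ℕ → (∀ i, A i) → ℝ) : Prop :=
  ∀ (n : ℕ) (x : ∀ i, A i), ∑ a : A n, Real.exp (φ n (Function.update x n a)) = 1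

/-- The symbolic map `(xᵢ) ↦ (πᵢ xᵢ)`. -/
def symbolicMap {A B : ℕ → Type*} (π : ∀ i, A i → B i) (x : ∀ i, A i) : ∀ i, B i :=
  fun i => π i (x i)

/-- The tail `(y n, y (n+1), …)`. -/
def tail {B : ℕ → Type*} (n : ℕ) (y : ∀ i, B i) : ∀ i : Set.Ici n, B i :=
  (Set.Ici n).domRestrict y

/-- `κ` is a version, continuous for the weak topology on probability measures, of the conditional
law under `μ` of the point `x` itself given the value of `Y x`. -/
def IsContinuousCondLaw {X E : Type*} [TopologicalSpace X] [MeasurableSpace X]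
    [OpensMeasurableSpace X] [StandardBorelSpace X] [Nonempty X] [TopologicalSpace E]
    [MeasurableSpace E] (μ : Measure X) [IsFiniteMeasure μ] (Y : X → E)
    (κ : E → ProbabilityMeasure X) : Prop :=
  Continuous κ ∧ ∀ᵐ e ∂(μ.map Y), (κ e : Measure X) = condDistrib id Y μ e

/-- `p̃ₙ(y) = ∫ ∑_{a ∈ πₙ⁻¹(yₙ)} exp (φₙ(a, x (n+1), …)) dκ_{n+1}(x)`, where the conditional law
`κ_{n+1}` is taken at the tail `(y (n+1), y (n+2), …)`. The integrand is a function of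
`(x (n+1), x (n+2), …)`. -/
noncomputable def factorDensity {A B : ℕ → Type*} [∀ i, Fintype (A i)] [∀ i, DecidableEq (B i)]
    [∀ i, TopologicalSpace (A i)] [∀ i, MeasurableSpace (A i)]
    (φ : ℕ → (∀ i, A i) → ℝ) (π : ∀ i, A i → B i)
    (κ : ∀ n : ℕ, (∀ i : Set.Ici n, B i) → ProbabilityMeasure (∀ i, A i))
    (n : ℕ) (y : ∀ i, B i) : ℝ :=
  ∫ x, ∑ a : A n with π n a = y n, Real.exp (φ n (Function.update x n a))
    ∂(κ (n + 1) (tail (n + 1) y) : Measure (∀ i, A i))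

end SymbolicFactor

/-!
Fix a fibre of the factor map, and let the coordinates below `N` be distributed with weight
`exp (φ 0 + ⋯ + φ (N - 1))` on the fibre, given the later coordinates. The crux is that these block
means of a continuous function converge as `N → ∞`, uniformly in the later coordinates and in the
fibre (`exists_fibreMean_sub_le`). Restricting the alphabets to the fibre does not affect the
variations of the potentials, so this is Berbee's uniqueness theorem on each fibre.

To prove it, write `exp (φ i)` as a random mixture: let `lowPot φ i k` be the infimum of `φ i` over
the cylinder of length `k`, and let each index `i` choose a range `k` such that its range is at most
`k` with probability `exp (lowPot φ i k - φ i)`. An index `l` over which no range of an index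
`i < l` reaches is a renewal. Given a renewal at `l`, the coordinates below `l` are independent of
the later ones and their law does not depend on anything else (`blockMean_renewal`). Deciding by the last
renewal in a set `S`, the mean of a local function is a mixture of the numbers `freeMean … l`,
`l ∈ S`, up to the probability that there is no renewal in `S` (`exists_mixture`). Since a range is
at most `k` with probability at least `exp (-r k)`, the latter is bounded by the probability that a
renewal process with renewal probabilities `exp (-r 1 - ⋯ - r n)` avoids `S`. Under Berbee's
condition this process is recurrent (`tendsto_avoidProb_Icc`). Therefore `freeMean` converges: if it
did not, the process would avoid, each with probability at least `3 / 4`, the indices at which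
`freeMean` is well below its limit superior and those at which it is well above its limit inferior,
although these sets cover all large indices (`exists_tendsto_freeMean`). Convergence of the block
means for one fibre follows, and compactness makes it uniform in the fibre.

The limits are the laws on the fibres, continuous in the fibre (`exists_isFibreLaw`,
`IsFibreLaw.continuous`). A Gibbs measure `μ` is the mixture of them
(`IsGibbs.integral_eq_integral_fibreLaw`), which makes them a version of the conditional law, and a
continuous version is unique because `μ` charges all open sets. Fibres are described by a family of
equivalence relations on the alphabets; this covers the conditioning on `π x` and on its tails alike
(`existsUnique_isContinuousCondLaw`).

For a normalised potential, being Gibbs amounts to the invariance of the measure when the coordinate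
`n` is resampled given the later ones, for functions of the coordinates from `n` on
(`isGibbs_of_stepMean`). For `μ` and a function of `π x`, this resampling has a density which
depends on `x`, and conditioning on the tail of `π x` replaces it by `factorDensity`
(`isGibbs_log_factorDensity`).
-/

namespace SymbolicFactor

open Filter Topology

/-! ### Sums over finitely many coordinates -/

theorem continuous_updateFinset_left {A : ℕ → Type*} [∀ i, TopologicalSpace (A i)] (Λ : Finset ℕ)
    (a : ∀ i : Λ, A i) : Continuous fun x : ∀ i, A i => Function.updateFinset x Λ a := by
  refine continuous_pi fun i => ?_
  by_cases h : i ∈ Λ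
  · simpa [Function.updateFinset, h] using continuous_const
  · simpa [Function.updateFinset, h] using continuous_apply i

theorem disjoint_Ici_range (n : ℕ) : Disjoint (Set.Ici n) (Finset.range n : Set ℕ) := by
  rw [Set.disjoint_left]
  intro i hi hi'
  simp only [Finset.coe_range, Set.mem_Iio, Set.mem_Ici] at hi hi'
  omega

section SumOver

variable {A : ℕ → Type*} [∀ i, Fintype (A i)]

/-- `sumOver Λ F x` is the sum of `F` over all configurations that coincide with `x` outside the
finite set `Λ` of coordinates. -/
def sumOver (Λ : Finset ℕ) (F : (∀ i, A i) → ℝ) (x : ∀ i, A i) : ℝ :=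
  ∑ a : (∀ i : Λ, A i), F (Function.updateFinset x Λ a)

theorem sumOver_empty (F : (∀ i, A i) → ℝ) : sumOver ∅ F = F := by
  funext x
  simp [sumOver]

theorem sumOver_singleton (n : ℕ) (F : (∀ i, A i) → ℝ) (x : ∀ i, A i) :
    sumOver {n} F x = ∑ a, F (Function.update x n a) := by
  unfold sumOver
  refine Fintype.sum_equiv (Equiv.piUnique (fun i : ({n} : Finset ℕ) => A i)) _ _ fun a => ?_
  rw [Function.updateFinset_singleton]
  rfl

theorem sumOver_union {s t : Finset ℕ} (h : Disjoint s t) (F : (∀ i, A i) → ℝ) :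
    sumOver s (sumOver t F) = sumOver (s ∪ t) F := by
  funext x
  unfold sumOver
  rw [← Fintype.sum_prod_type'
    (f := fun y z => F (Function.updateFinset (Function.updateFinset x s y) t z))]
  refine Fintype.sum_equiv (Equiv.piFinsetUnion A h) _ _ fun p => ?_
  rw [Function.updateFinset_updateFinset h]

theorem sumOver_dependsOn {F : (∀ i, A i) → ℝ} {S : Set ℕ} (hF : DependsOn F S)
    (Λ : Finset ℕ) : DependsOn (sumOver Λ F) (S \ Λ) := by
  intro x y hxy
  refine Finset.sum_congr rfl fun a _ => hF fun i hi => ?_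
  by_cases h : i ∈ Λ
  · simp [Function.updateFinset, h]
  · simpa [Function.updateFinset, h] using hxy i ⟨hi, h⟩

theorem sumOver_mul_left {G : (∀ i, A i) → ℝ} {S : Set ℕ} (hG : DependsOn G S) {Λ : Finset ℕ}
    (hS : Disjoint S Λ) (F : (∀ i, A i) → ℝ) (x : ∀ i, A i) :
    sumOver Λ (fun x => G x * F x) x = G x * sumOver Λ F x := by
  unfold sumOver
  rw [Finset.mul_sum]
  refine Finset.sum_congr rfl fun a _ => ?_
  have : G (Function.updateFinset x Λ a) = G x := hG fun i hi => by
    have h : i ∉ Λ := fun h => Set.disjoint_left.1 hS hi h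
    simp [Function.updateFinset, h]
  rw [← this]

theorem sumOver_const_mul (Λ : Finset ℕ) (c : ℝ) (F : (∀ i, A i) → ℝ) (x : ∀ i, A i) :
    sumOver Λ (fun x => c * F x) x = c * sumOver Λ F x := by
  simp only [sumOver, Finset.mul_sum]

theorem sumOver_add (Λ : Finset ℕ) (F G : (∀ i, A i) → ℝ) (x : ∀ i, A i) :
    sumOver Λ (fun x => F x + G x) x = sumOver Λ F x + sumOver Λ G x :=
  Finset.sum_add_distrib

theorem sumOver_sum {ι : Type*} (Λ : Finset ℕ) (s : Finset ι) (F : ι → (∀ i, A i) → ℝ)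
    (x : ∀ i, A i) :
    sumOver Λ (fun x => ∑ l ∈ s, F l x) x = ∑ l ∈ s, sumOver Λ (F l) x :=
  Finset.sum_comm

theorem sumOver_mono (Λ : Finset ℕ) {F G : (∀ i, A i) → ℝ} (h : ∀ x, F x ≤ G x)
    (x : ∀ i, A i) : sumOver Λ F x ≤ sumOver Λ G x :=
  Finset.sum_le_sum fun _ _ => h _

theorem sumOver_nonneg (Λ : Finset ℕ) {F : (∀ i, A i) → ℝ} (h : ∀ x, 0 ≤ F x)
    (x : ∀ i, A i) : 0 ≤ sumOver Λ F x :=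
  Finset.sum_nonneg fun _ _ => h _

/-- If two functions have the same sums over `Λ`, they have the same sums over every larger set. -/
theorem sumOver_congr_of_subset {Λ Λ' : Finset ℕ} (h : Λ ⊆ Λ') {F G : (∀ i, A i) → ℝ}
    (hFG : sumOver Λ F = sumOver Λ G) : sumOver Λ' F = sumOver Λ' G := by
  rw [← Finset.sdiff_union_of_subset h, ← sumOver_union Finset.sdiff_disjoint, hFG,
    sumOver_union Finset.sdiff_disjoint]

theorem sumOver_pos {F : (∀ i, A i) → ℝ} (h : ∀ x, 0 ≤ F x) {x y : ∀ i, A i} {Λ : Finset ℕ}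
    (hxy : ∀ i ∉ Λ, x i = y i) (hy : 0 < F y) : 0 < sumOver Λ F x := by
  refine Finset.sum_pos' (fun _ _ => h _) ⟨fun i => y i, Finset.mem_univ _, ?_⟩
  have : Function.updateFinset x Λ (fun i : Λ => y i) = y := by
    funext i
    by_cases hi : i ∈ Λ
    · simp [Function.updateFinset, hi]
    · simp [Function.updateFinset, hi, hxy]
  rwa [this]

theorem continuous_sumOver [∀ i, TopologicalSpace (A i)] (Λ : Finset ℕ) {F : (∀ i, A i) → ℝ}
    (hF : Continuous F) : Continuous (sumOver Λ F) :=
  continuous_finsetSum _ fun a _ => hF.comp (continuous_updateFinset_left Λ a)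

end SumOver

/-! ### Avoidance probabilities of renewal sets -/

/-- The law of a sequence of independent uniform random variables on `[0, 1]`. -/
noncomputable abbrev uniformSeq : Measure (ℕ → unitInterval) :=
  Measure.infinitePi fun _ => volume

/-- The event that `j` is a renewal when only the indices `i ≥ l` are looked at: each index
`i ∈ [l, j)` has a range `k i`, namely the least `k` with `ω i ≤ c i k`, and none of these
ranges reaches over `j`. -/
def renewal (c : ℕ → ℕ → ℝ) (l j : ℕ) : Set (ℕ → unitInterval) :=
  {ω | ∀ i ∈ Finset.Ico l j, (ω i : ℝ) ≤ c i (j - i)}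

/-- The event that no element of `S` to the right of `l` is a renewal for the indices `i ≥ l`. -/
def avoid (c : ℕ → ℕ → ℝ) (l : ℕ) (S : Finset ℕ) : Set (ℕ → unitInterval) :=
  {ω | ∀ j ∈ S, l < j → ω ∉ renewal c l j}

/-- The probability that no element of `S` to the right of `l` is a renewal. -/
noncomputable def avoidProb (c : ℕ → ℕ → ℝ) (l : ℕ) (S : Finset ℕ) : ℝ :=
  uniformSeq.real (avoid c l S)

theorem measurableSet_renewal (c : ℕ → ℕ → ℝ) (l j : ℕ) : MeasurableSet (renewal c l j) := by
  have : renewal c l j = ⋂ i ∈ Finset.Ico l j, {ω | (ω i : ℝ) ≤ c i (j - i)} := by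
    ext; simp [renewal]
  rw [this]
  exact Finset.measurableSet_biInter _ fun i _ =>
    measurableSet_le (measurable_subtype_coe.comp (measurable_pi_apply i)) measurable_const

theorem measurableSet_avoid (c : ℕ → ℕ → ℝ) (l : ℕ) (S : Finset ℕ) :
    MeasurableSet (avoid c l S) := by
  have : avoid c l S = ⋂ j ∈ S.filter (l < ·), (renewal c l j)ᶜ := by
    ext; simp [avoid]
  rw [this]
  exact Finset.measurableSet_biInter _ fun j _ => (measurableSet_renewal c l j).compl

theorem uniformSeq_renewal {c : ℕ → ℕ → ℝ} {l j : ℕ}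
    (hc : ∀ i, l ≤ i → i < j → c i (j - i) ∈ Set.Icc (0 : ℝ) 1) :
    uniformSeq.real (renewal c l j) = ∏ i ∈ Finset.Ico l j, c i (j - i) := by
  have : renewal c l j
      = Set.pi (Finset.Ico l j : Set ℕ) fun i => {t : unitInterval | (t : ℝ) ≤ c i (j - i)} := by
    ext; simp [renewal, Set.mem_pi]
  rw [this, Measure.real, Measure.infinitePi_pi _ fun i _ =>
    measurableSet_le measurable_subtype_coe measurable_const, ENNReal.toReal_prod]
  refine Finset.prod_congr rfl fun i hi => ?_
  rw [Finset.mem_Ico] at hi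
  have h := hc i hi.1 hi.2
  have : {t : unitInterval | (t : ℝ) ≤ c i (j - i)} = Set.Iic ⟨c i (j - i), h⟩ := by
    ext; simp [← Subtype.coe_le_coe]
  rw [this, unitInterval.volume_Iic, ENNReal.toReal_ofReal h.1]

theorem uniformSeq_renewal_inter_avoid (c : ℕ → ℕ → ℝ) (l j : ℕ) (S : Finset ℕ) :
    uniformSeq.real (renewal c l j ∩ avoid c j S)
      = uniformSeq.real (renewal c l j) * avoidProb c j S := by
  have hind : iIndepFun (fun (i : ℕ) (ω : ℕ → unitInterval) => ω i) uniformSeq :=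
    iIndepFun_infinitePi (X := fun _ ω => ω) (fun _ => measurable_id)
  have hdisj : Disjoint (Finset.Ico l j) (Finset.Ico j (S.sup id)) := by
    rw [Finset.disjoint_left]
    intro i hi hi'
    rw [Finset.mem_Ico] at hi hi'
    omega
  have h := hind.indepFun_finset _ _ hdisj fun i => measurable_pi_apply i
  rw [indepFun_iff_measure_inter_preimage_eq_mul] at h
  set s : Set (∀ _ : Finset.Ico l j, unitInterval) :=
    {ω | ∀ i : Finset.Ico l j, (ω i : ℝ) ≤ c i (j - i)} with hs
  set t : Set (∀ _ : Finset.Ico j (S.sup id), unitInterval) :=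
    ⋂ m ∈ S.filter (j < ·), {ω | ∀ i : Finset.Ico j (S.sup id), (i : ℕ) < m →
      (ω i : ℝ) ≤ c i (m - i)}ᶜ with ht
  have hsm : MeasurableSet s := by
    have : s = ⋂ i : Finset.Ico l j, {ω | (ω i : ℝ) ≤ c i (j - i)} := by ext; simp [hs]
    rw [this]
    exact MeasurableSet.iInter fun i =>
      measurableSet_le (measurable_subtype_coe.comp (measurable_pi_apply i)) measurable_const
  have htm : MeasurableSet t := by
    refine Finset.measurableSet_biInter _ fun m _ => MeasurableSet.compl ?_
    have : {ω : ∀ _ : Finset.Ico j (S.sup id), unitInterval |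
        ∀ i : Finset.Ico j (S.sup id), (i : ℕ) < m → (ω i : ℝ) ≤ c i (m - i)}
        = ⋂ i : Finset.Ico j (S.sup id), ⋂ _ : (i : ℕ) < m, {ω | (ω i : ℝ) ≤ c i (m - i)} := by
      ext; simp
    rw [this]
    exact MeasurableSet.iInter fun i => MeasurableSet.iInter fun _ =>
      measurableSet_le (measurable_subtype_coe.comp (measurable_pi_apply i)) measurable_const
  have h1 : renewal c l j
      = (fun (ω : ℕ → unitInterval) (i : Finset.Ico l j) => ω i) ⁻¹' s := by
    ext; simp [renewal, hs]
  have h2 : avoid c j S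
      = (fun (ω : ℕ → unitInterval) (i : Finset.Ico j (S.sup id)) => ω i) ⁻¹' t := by
    ext ω
    simp only [avoid, renewal, ht, Set.mem_ofPred_eq, Set.mem_preimage, Set.mem_iInter,
      Set.mem_compl_iff, Finset.mem_filter, and_imp]
    refine forall₃_congr fun m hm _ => not_congr ⟨fun H i him => H i ?_, fun H i hi => ?_⟩
    · have := i.2
      simp only [Finset.mem_Ico] at this ⊢
      omega
    · rw [Finset.mem_Ico] at hi
      exact H ⟨i, Finset.mem_Ico.2 ⟨hi.1, hi.2.trans_le (Finset.le_sup (f := id) hm)⟩⟩ hi.2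
  have := h s t hsm htm
  rw [avoidProb, Measure.real, Measure.real, Measure.real, ← ENNReal.toReal_mul]
  congr 1
  rw [h1, h2]
  exact this

/-- Decomposition according to the last renewal in `S`. -/
theorem avoidProb_add_sum {c : ℕ → ℕ → ℝ} {l : ℕ} {S : Finset ℕ}
    (hmono : ∀ i k k', 1 ≤ k → k ≤ k' → c i k ≤ c i k')
    (hc : ∀ j ∈ S, ∀ i, l ≤ i → i < j → c i (j - i) ∈ Set.Icc (0 : ℝ) 1) :
    avoidProb c l S + ∑ j ∈ S with l < j, (∏ i ∈ Finset.Ico l j, c i (j - i)) * avoidProb c j S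
      = 1 := by
  have hcompl : (avoid c l S)ᶜ = ⋃ j ∈ S.filter (l < ·), renewal c l j ∩ avoid c j S := by
    ext ω
    simp only [Set.mem_compl_iff, Set.mem_iUnion, Set.mem_inter_iff, Finset.mem_filter,
      exists_prop]
    constructor
    · intro h
      classical
      have hne : (S.filter fun j => l < j ∧ ω ∈ renewal c l j).Nonempty := by
        simp only [avoid, Set.mem_ofPred_eq, not_forall, not_not] at h
        obtain ⟨j, hj, hlj, hω⟩ := h
        exact ⟨j, Finset.mem_filter.2 ⟨hj, hlj, hω⟩⟩
      obtain ⟨j, hj, hmax⟩ := Finset.exists_max_image _ id hne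
      rw [Finset.mem_filter] at hj
      refine ⟨j, ⟨hj.1, hj.2.1⟩, hj.2.2, fun m hm hjm hω => ?_⟩
      have : m ≤ j := hmax m <| Finset.mem_filter.2 ⟨hm, hj.2.1.trans hjm, fun i hi => ?_⟩
      · omega
      · rw [Finset.mem_Ico] at hi
        rcases lt_or_ge i j with hij | hij
        · exact (hj.2.2 i (Finset.mem_Ico.2 ⟨hi.1, hij⟩)).trans
            (hmono _ _ _ (by omega) (by omega))
        · exact hω i (Finset.mem_Ico.2 ⟨hij, hi.2⟩)
    · rintro ⟨j, ⟨hj, hlj⟩, hω, -⟩ h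
      exact h j hj hlj hω
  have hsum : uniformSeq.real (avoid c l S)ᶜ
      = ∑ j ∈ S with l < j, (∏ i ∈ Finset.Ico l j, c i (j - i)) * avoidProb c j S := by
    rw [hcompl, measureReal_biUnion_finset]
    · refine Finset.sum_congr rfl fun j hj => ?_
      rw [Finset.mem_filter] at hj
      rw [uniformSeq_renewal_inter_avoid, uniformSeq_renewal (hc j hj.1)]
    · have key : ∀ j m, m ∈ S → l < j → j < m →
          Disjoint (renewal c l j ∩ avoid c j S) (renewal c l m ∩ avoid c m S) := by
        intro j m hm hlj hjm
        rw [Set.disjoint_left]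
        rintro ω ⟨-, h⟩ ⟨h', -⟩
        refine h m hm hjm fun i hi => h' i ?_
        rw [Finset.mem_Ico] at hi ⊢
        omega
      intro j hj m hm hjm
      simp only [Finset.coe_filter, Set.mem_ofPred_eq] at hj hm
      rcases lt_or_gt_of_ne hjm with h | h
      · exact key j m hm.1 hj.2 h
      · exact (key m j hj.1 hm.2 h).symm
    · exact fun j _ => (measurableSet_renewal c l j).inter (measurableSet_avoid c j S)
  rw [← hsum, avoidProb, probReal_compl_eq_one_sub (measurableSet_avoid c l S)]
  ring

theorem avoidProb_nonneg (c : ℕ → ℕ → ℝ) (l : ℕ) (S : Finset ℕ) : 0 ≤ avoidProb c l S :=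
  measureReal_nonneg

/-- Larger thresholds mean shorter ranges, hence more renewals. -/
theorem avoidProb_anti {c c' : ℕ → ℕ → ℝ} {l : ℕ} {S : Finset ℕ}
    (h : ∀ j ∈ S, ∀ i, l ≤ i → i < j → c i (j - i) ≤ c' i (j - i)) :
    avoidProb c' l S ≤ avoidProb c l S := by
  refine measureReal_mono fun ω hω j hj hlj hr => hω j hj hlj fun i hi => ?_
  have := Finset.mem_Ico.1 hi
  exact (hr i hi).trans (h j hj i this.1 this.2)

theorem avoidProb_anti_right (c : ℕ → ℕ → ℝ) {l : ℕ} {S T : Finset ℕ}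
    (h : ∀ j ∈ S, l < j → j ∈ T) : avoidProb c l T ≤ avoidProb c l S :=
  measureReal_mono fun _ hω j hj hlj => hω j (h j hj hlj) hlj

theorem avoidProb_congr_right (c : ℕ → ℕ → ℝ) {l : ℕ} {S T : Finset ℕ}
    (h : ∀ j, l < j → (j ∈ S ↔ j ∈ T)) : avoidProb c l S = avoidProb c l T :=
  le_antisymm (avoidProb_anti_right c fun j hj hlj => (h j hlj).2 hj)
    (avoidProb_anti_right c fun j hj hlj => (h j hlj).1 hj)

theorem avoidProb_congr_left {c c' : ℕ → ℕ → ℝ} {l : ℕ} (S : Finset ℕ)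
    (h : ∀ i, l ≤ i → c i = c' i) : avoidProb c l S = avoidProb c' l S :=
  le_antisymm (avoidProb_anti fun _ _ i hi _ => by rw [h i hi])
    (avoidProb_anti fun _ _ i hi _ => by rw [h i hi])

/-- Two sets which are avoided with high probability are avoided simultaneously with positive
probability. -/
theorem avoidProb_add_le (c : ℕ → ℕ → ℝ) (l : ℕ) (S T : Finset ℕ) :
    avoidProb c l S + avoidProb c l T ≤ 1 + avoidProb c l (S ∪ T) := by
  have h := measureReal_union_add_inter (μ := uniformSeq) (s := avoid c l S)
    (measurableSet_avoid c l T)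
  have h1 : uniformSeq.real (avoid c l S ∪ avoid c l T) ≤ 1 := measureReal_le_one
  have h2 : avoid c l S ∩ avoid c l T = avoid c l (S ∪ T) := by
    ext ω
    simp only [avoid, Set.mem_inter_iff, Set.mem_ofPred_eq, Finset.mem_union]
    exact ⟨fun H j hj => hj.elim (H.1 j) (H.2 j),
      fun H => ⟨fun j hj => H j (.inl hj), fun j hj => H j (.inr hj)⟩⟩
  rw [h2] at h
  simp only [avoidProb]
  linarith

/-! ### Recurrence under Berbee's condition -/

section Recurrence

variable {r : ℕ → ℝ}

theorem prod_exp_neg_eq (r : ℕ → ℝ) (l j : ℕ) :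
    ∏ i ∈ Finset.Ico l j, Real.exp (-r (j - i))
      = Real.exp (-∑ k ∈ Finset.Icc 1 (j - l), r k) := by
  rw [← Finset.sum_neg_distrib, Real.exp_sum]
  refine Finset.prod_nbij' (fun i => j - i) (fun k => j - k) ?_ ?_ ?_ ?_ fun _ _ => rfl
  all_goals
    simp only [Finset.mem_Ico, Finset.mem_Icc]
    intros
    omega

theorem avoidProb_exp_add_sum (h0 : ∀ k, 1 ≤ k → 0 ≤ r k)
    (hanti : ∀ k k', 1 ≤ k → k ≤ k' → r k' ≤ r k) (l : ℕ) (S : Finset ℕ) :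
    avoidProb (fun _ k => Real.exp (-r k)) l S
      + ∑ j ∈ S with l < j, Real.exp (-∑ k ∈ Finset.Icc 1 (j - l), r k)
          * avoidProb (fun _ k => Real.exp (-r k)) j S = 1 := by
  rw [← avoidProb_add_sum (c := fun _ k => Real.exp (-r k)) (l := l) (S := S)]
  · simp only [prod_exp_neg_eq]
  · intro i k k' hk hkk'
    exact Real.exp_le_exp.2 (neg_le_neg (hanti k k' hk hkk'))
  · intro j _ i _ hij
    exact ⟨(Real.exp_pos _).le, Real.exp_le_one_iff.2 (neg_nonpos.2 (h0 _ (by omega)))⟩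

/-- For the thresholds `exp (-r k)`, the same at every index, the avoidance probabilities are
invariant under translations. -/
theorem avoidProb_exp_shift (h0 : ∀ k, 1 ≤ k → 0 ≤ r k)
    (hanti : ∀ k k', 1 ≤ k → k ≤ k' → r k' ≤ r k) (n : ℕ) : ∀ l,
    avoidProb (fun _ k => Real.exp (-r k)) l (Finset.Ioc l (l + n))
      = avoidProb (fun _ k => Real.exp (-r k)) 0 (Finset.Ioc 0 n) := by
  induction n using Nat.strong_induction_on with
  | _ n ih =>
    intro l
    have key : ∀ l, avoidProb (fun _ k => Real.exp (-r k)) l (Finset.Ioc l (l + n))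
        = 1 - ∑ m ∈ Finset.Ioc 0 n, Real.exp (-∑ k ∈ Finset.Icc 1 m, r k)
          * avoidProb (fun _ k => Real.exp (-r k)) 0 (Finset.Ioc 0 (n - m)) := by
      intro l
      rw [← avoidProb_exp_add_sum h0 hanti l (Finset.Ioc l (l + n)), eq_sub_iff_add_eq]
      congr 1
      refine Finset.sum_nbij' (· + l) (· - l) ?_ ?_ ?_ ?_ ?_
      · intro m hm
        simp only [Finset.mem_Ioc, Finset.mem_filter] at hm ⊢
        omega
      · intro m hm
        simp only [Finset.mem_Ioc, Finset.mem_filter] at hm ⊢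
        omega
      · intro m _
        omega
      · intro m hm
        simp only [Finset.mem_Ioc, Finset.mem_filter] at hm
        omega
      · intro m hm
        rw [Finset.mem_Ioc] at hm
        rw [Nat.add_sub_cancel, ← ih (n - m) (by omega) (m + l)]
        congr 1
        refine avoidProb_congr_right _ fun j hj => ?_
        simp only [Finset.mem_Ioc]
        omega
    rw [key l, ← key 0, zero_add]

theorem avoidProb_exp_eq_of_le (h0 : ∀ k, 1 ≤ k → 0 ≤ r k)
    (hanti : ∀ k k', 1 ≤ k → k ≤ k' → r k' ≤ r k) {M N j : ℕ} (hM : M ≤ j + 1) (hj : j ≤ N) :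
    avoidProb (fun _ k => Real.exp (-r k)) j (Finset.Icc M N)
      = avoidProb (fun _ k => Real.exp (-r k)) 0 (Finset.Ioc 0 (N - j)) := by
  rw [← avoidProb_exp_shift h0 hanti (N - j) j]
  refine avoidProb_congr_right _ fun m hm => ?_
  simp only [Finset.mem_Ioc, Finset.mem_Icc]
  omega

/-- The decomposition according to the last renewal in `[0, N]`, where `0` is a renewal. -/
theorem sum_exp_mul_avoidProb (h0 : ∀ k, 1 ≤ k → 0 ≤ r k)
    (hanti : ∀ k k', 1 ≤ k → k ≤ k' → r k' ≤ r k) (N : ℕ) :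
    ∑ j ∈ Finset.range (N + 1), Real.exp (-∑ k ∈ Finset.Icc 1 j, r k)
      * avoidProb (fun _ k => Real.exp (-r k)) 0 (Finset.Ioc 0 (N - j)) = 1 := by
  rw [Finset.sum_range_succ', ← avoidProb_exp_add_sum h0 hanti 0 (Finset.Icc 1 N), add_comm,
    avoidProb_exp_eq_of_le h0 hanti (by omega) (Nat.zero_le N)]
  congr 1
  · simp
  · refine Finset.sum_nbij' (· + 1) (· - 1) ?_ ?_ ?_ ?_ ?_
    all_goals
      intro m hm
      simp only [Finset.mem_range, Finset.mem_Icc, Finset.mem_filter] at hm ⊢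
    · omega
    · omega
    · omega
    · omega
    · rw [avoidProb_exp_eq_of_le h0 hanti (by omega) (by omega), Nat.sub_zero]

/-- A renewal process whose renewal probabilities `exp (-r 1 - ⋯ - r n)` have infinite sum is
recurrent, so it visits long intervals with high probability. -/
theorem tendsto_avoidProb_Icc (h0 : ∀ k, 1 ≤ k → 0 ≤ r k)
    (hanti : ∀ k k', 1 ≤ k → k ≤ k' → r k' ≤ r k)
    (hr : ¬ Summable fun n => Real.exp (-∑ k ∈ Finset.Icc 1 n, r k)) (M : ℕ) :
    Tendsto (fun N => avoidProb (fun _ k => Real.exp (-r k)) 0 (Finset.Icc M N)) atTop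
      (𝓝 0) := by
  set u : ℕ → ℝ := fun n => Real.exp (-∑ k ∈ Finset.Icc 1 n, r k) with hu
  set v : ℕ → ℝ := fun n => avoidProb (fun _ k => Real.exp (-r k)) 0 (Finset.Ioc 0 n) with hv
  have hv0 : ∀ n, 0 ≤ v n := fun n => avoidProb_nonneg _ _ _
  have hvanti : Antitone v := fun m n hmn => avoidProb_anti_right _ fun j hj _ => by
    simp only [Finset.mem_Ioc] at hj ⊢
    omega
  have hu0 : ∀ n, 0 ≤ u n := fun n => (Real.exp_pos _).le
  have hu1 : ∀ n, u n ≤ 1 := fun n => Real.exp_le_one_iff.2 <| neg_nonpos.2 <|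
    Finset.sum_nonneg fun k hk => h0 k (Finset.mem_Icc.1 hk).1
  have hone : ∀ N, ∑ j ∈ Finset.range (N + 1), u j * v (N - j) = 1 :=
    sum_exp_mul_avoidProb h0 hanti
  have hU : Tendsto (fun N => ∑ j ∈ Finset.range N, u j) atTop atTop :=
    (not_summable_iff_tendsto_nat_atTop_of_nonneg hu0).1 hr
  have hU' : Tendsto (fun N => ∑ j ∈ Finset.range (N + 1), u j) atTop atTop :=
    hU.comp (tendsto_add_atTop_nat 1)
  -- The sum `hone` is at least `v N * ∑ u j`, and the series `∑ u j` diverges.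
  have hvlim : Tendsto v atTop (𝓝 0) := by
    refine squeeze_zero' (.of_forall hv0) ?_ hU'.inv_tendsto_atTop
    filter_upwards [hU'.eventually_gt_atTop 0] with N hN
    rw [Pi.inv_apply, ← one_div, le_div_iff₀ hN, ← hone N, mul_comm, Finset.sum_mul]
    exact Finset.sum_le_sum fun j _ => mul_le_mul_of_nonneg_left (hvanti (Nat.sub_le N j)) (hu0 j)
  refine squeeze_zero' (.of_forall fun N => avoidProb_nonneg _ _ _)
    (g := fun N => (M + 1) * v (N - M)) ?_ ?_
  -- The last renewal in `[0, N]` has to be one of the `M + 1` indices up to `M`.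
  · filter_upwards [eventually_ge_atTop M] with N hN
    have h1 := avoidProb_exp_add_sum h0 hanti 0 (Finset.Icc (M + 1) N)
    have h2 : avoidProb (fun _ k => Real.exp (-r k)) 0 (Finset.Icc M N)
        ≤ avoidProb (fun _ k => Real.exp (-r k)) 0 (Finset.Icc (M + 1) N) :=
      avoidProb_anti_right _ fun j hj _ => by
        simp only [Finset.mem_Icc] at hj ⊢
        omega
    have h3 : ∑ j ∈ Finset.Icc (M + 1) N with 0 < j,
        Real.exp (-∑ k ∈ Finset.Icc 1 (j - 0), r k)
          * avoidProb (fun _ k => Real.exp (-r k)) j (Finset.Icc (M + 1) N)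
        = ∑ j ∈ Finset.Ico (M + 1) (N + 1), u j * v (N - j) := by
      refine Finset.sum_congr ?_ fun j hj => ?_
      · ext j
        simp only [Finset.mem_filter, Finset.mem_Icc, Finset.mem_Ico]
        omega
      · rw [Finset.mem_Ico] at hj
        rw [avoidProb_exp_eq_of_le h0 hanti (by omega) (by omega), Nat.sub_zero]
    have h4 := hone N
    rw [← Finset.sum_range_add_sum_Ico _ (show M + 1 ≤ N + 1 by omega)] at h4
    have h5 : ∑ j ∈ Finset.range (M + 1), u j * v (N - j) ≤ (M + 1) * v (N - M) := by
      have : ∀ j ∈ Finset.range (M + 1), u j * v (N - j) ≤ v (N - M) := fun j hj => by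
        rw [Finset.mem_range] at hj
        calc u j * v (N - j) ≤ 1 * v (N - j) := mul_le_mul_of_nonneg_right (hu1 j) (hv0 _)
          _ = v (N - j) := one_mul _
          _ ≤ v (N - M) := hvanti (by omega)
      simpa using Finset.sum_le_card_nsmul _ _ _ this
    rw [h3] at h1
    linarith
  · have := (hvlim.comp (tendsto_sub_atTop_nat M)).const_mul ((M : ℝ) + 1)
    simpa using this

end Recurrence

/-! ### Weighted means over a block of coordinates -/

section Mean

variable {A : ℕ → Type*}

/-- The product over `i ∈ s` of `χ i (x i) * exp (ψ i x)`. The factors `χ i` restrict the alphabets: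
they are indicator functions in the applications. -/
noncomputable def weight (χ : ∀ i, A i → ℝ) (ψ : ℕ → (∀ i, A i) → ℝ) (s : Finset ℕ)
    (x : ∀ i, A i) : ℝ :=
  ∏ i ∈ s, χ i (x i) * Real.exp (ψ i x)

theorem weight_nonneg {χ : ∀ i, A i → ℝ} (hχ : ∀ i a, 0 ≤ χ i a) (ψ : ℕ → (∀ i, A i) → ℝ)
    (s : Finset ℕ) (x : ∀ i, A i) : 0 ≤ weight χ ψ s x :=
  Finset.prod_nonneg fun i _ => mul_nonneg (hχ i _) (Real.exp_pos _).le

theorem weight_dependsOn {χ : ∀ i, A i → ℝ} {ψ : ℕ → (∀ i, A i) → ℝ} {s : Finset ℕ} {T : Set ℕ}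
    (hs : ↑s ⊆ T) (hψ : ∀ i ∈ s, DependsOn (ψ i) T) : DependsOn (weight χ ψ s) T := by
  intro x y hxy
  refine Finset.prod_congr rfl fun i hi => ?_
  rw [hxy i (hs hi), hψ i hi hxy]

variable [∀ i, Fintype (A i)]

/-- The mean of `f` over all ways to change `x` in the coordinates below `N`, with respect to the
weight given by `χ` and `ψ`. -/
noncomputable def blockMean (χ : ∀ i, A i → ℝ) (ψ : ℕ → (∀ i, A i) → ℝ) (N : ℕ)
    (f : (∀ i, A i) → ℝ) (x : ∀ i, A i) : ℝ :=
  sumOver (Finset.range N) (fun x => weight χ ψ (Finset.range N) x * f x) x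
    / sumOver (Finset.range N) (weight χ ψ (Finset.range N)) x

variable {χ : ∀ i, A i → ℝ} {ψ : ℕ → (∀ i, A i) → ℝ} {N : ℕ}

theorem sumOver_weight_pos (hχ : ∀ i a, 0 ≤ χ i a) (hχ' : ∀ i, ∃ a, 0 < χ i a)
    (ψ : ℕ → (∀ i, A i) → ℝ) (N : ℕ) (x : ∀ i, A i) :
    0 < sumOver (Finset.range N) (weight χ ψ (Finset.range N)) x := by
  choose a ha using hχ'
  refine sumOver_pos (weight_nonneg hχ ψ _) (y := fun i => if i < N then a i else x i) ?_ ?_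
  · intro i hi
    simp [Finset.mem_range.not.1 hi]
  · refine Finset.prod_pos fun i hi => mul_pos ?_ (Real.exp_pos _)
    simpa [Finset.mem_range.1 hi] using ha i

theorem blockMean_const (hχ : ∀ i a, 0 ≤ χ i a) (hχ' : ∀ i, ∃ a, 0 < χ i a) (c : ℝ)
    (x : ∀ i, A i) : blockMean χ ψ N (fun _ => c) x = c := by
  have h := sumOver_weight_pos hχ hχ' ψ N x
  simp only [blockMean, mul_comm _ c, sumOver_const_mul]
  field_simp

theorem blockMean_add (f g : (∀ i, A i) → ℝ) (x : ∀ i, A i) :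
    blockMean χ ψ N (fun x => f x + g x) x = blockMean χ ψ N f x + blockMean χ ψ N g x := by
  simp only [blockMean, mul_add, sumOver_add, add_div]

theorem blockMean_const_mul (c : ℝ) (f : (∀ i, A i) → ℝ) (x : ∀ i, A i) :
    blockMean χ ψ N (fun x => c * f x) x = c * blockMean χ ψ N f x := by
  simp only [blockMean, mul_left_comm _ c, sumOver_const_mul, mul_div_assoc]

theorem blockMean_sum {ι : Type*} (s : Finset ι) (f : ι → (∀ i, A i) → ℝ) (x : ∀ i, A i) :
    blockMean χ ψ N (fun x => ∑ l ∈ s, f l x) x = ∑ l ∈ s, blockMean χ ψ N (f l) x := by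
  simp only [blockMean, Finset.mul_sum, sumOver_sum, Finset.sum_div]

theorem blockMean_mono (hχ : ∀ i a, 0 ≤ χ i a) {f g : (∀ i, A i) → ℝ} (h : ∀ x, f x ≤ g x)
    (x : ∀ i, A i) : blockMean χ ψ N f x ≤ blockMean χ ψ N g x := by
  have hw := weight_nonneg hχ ψ (Finset.range N)
  exact div_le_div_of_nonneg_right
    (sumOver_mono _ (fun x => mul_le_mul_of_nonneg_left (h x) (hw x)) x) (sumOver_nonneg _ hw x)

theorem blockMean_nonneg (hχ : ∀ i a, 0 ≤ χ i a) {f : (∀ i, A i) → ℝ} (h : ∀ x, 0 ≤ f x)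
    (x : ∀ i, A i) : 0 ≤ blockMean χ ψ N f x := by
  have hw := weight_nonneg hχ ψ (Finset.range N)
  exact div_nonneg (sumOver_nonneg _ (fun x => mul_nonneg (hw x) (h x)) x)
    (sumOver_nonneg _ hw x)

theorem blockMean_le_const (hχ : ∀ i a, 0 ≤ χ i a) (hχ' : ∀ i, ∃ a, 0 < χ i a)
    {f : (∀ i, A i) → ℝ} {c : ℝ} (h : ∀ x, f x ≤ c) (x : ∀ i, A i) :
    blockMean χ ψ N f x ≤ c :=
  (blockMean_mono hχ h x).trans_eq (blockMean_const hχ hχ' c x)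

end Mean

/-! ### Infima of the potentials over cylinders -/

section LowPot

variable {A : ℕ → Type*}

/-- The infimum of `φ i` over the points that coincide with `x` on `[i, i + k)`. -/
noncomputable def lowPot (φ : ℕ → (∀ i, A i) → ℝ) (i k : ℕ) (x : ∀ i, A i) : ℝ :=
  ⨅ y : {y : ∀ i, A i // ∀ j, i ≤ j → j < i + k → y j = x j}, φ i y

/-- `r k`, for `k ≥ 1`, bounds the variation of each `φ n` over cylinders of length `k`. -/
def VariationBound (φ : ℕ → (∀ i, A i) → ℝ) (r : ℕ → ℝ) : Prop :=
  ∀ n k x y, 1 ≤ k → (∀ i, n ≤ i → i < n + k → x i = y i) → |φ n x - φ n y| ≤ r k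

variable {φ : ℕ → (∀ i, A i) → ℝ} {r : ℕ → ℝ}

theorem lowPot_dependsOn (φ : ℕ → (∀ i, A i) → ℝ) (i k : ℕ) :
    DependsOn (lowPot φ i k) (Set.Ico i (i + k)) := by
  intro x y hxy
  have : (fun z : ∀ i, A i => ∀ j, i ≤ j → j < i + k → z j = x j)
      = fun z => ∀ j, i ≤ j → j < i + k → z j = y j := by
    funext z
    exact propext (forall₃_congr fun j h1 h2 => by rw [hxy j ⟨h1, h2⟩])
  unfold lowPot
  rw [this]

theorem bddBelow_lowPot (hr : VariationBound φ r) {k : ℕ} (hk : 1 ≤ k) (i : ℕ) (x : ∀ i, A i) :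
    BddBelow (Set.range fun y : {y : ∀ i, A i // ∀ j, i ≤ j → j < i + k → y j = x j} =>
      φ i y) := by
  refine ⟨φ i x - r k, ?_⟩
  rintro _ ⟨⟨y, hy⟩, rfl⟩
  have := (abs_le.1 (hr i k y x hk hy)).1
  simp only
  linarith

theorem lowPot_le (hr : VariationBound φ r) {k : ℕ} (hk : 1 ≤ k) (i : ℕ) (x : ∀ i, A i) :
    lowPot φ i k x ≤ φ i x :=
  ciInf_le (bddBelow_lowPot hr hk i x) ⟨x, fun _ _ _ => rfl⟩

theorem le_lowPot_add (hr : VariationBound φ r) {k : ℕ} (hk : 1 ≤ k) (i : ℕ) (x : ∀ i, A i) :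
    φ i x ≤ lowPot φ i k x + r k := by
  rw [← sub_le_iff_le_add]
  have : Nonempty {y : ∀ i, A i // ∀ j, i ≤ j → j < i + k → y j = x j} :=
    ⟨⟨x, fun _ _ _ => rfl⟩⟩
  refine le_ciInf fun ⟨y, hy⟩ => ?_
  have := (abs_le.1 (hr i k y x hk hy)).1
  simp only
  linarith

theorem lowPot_mono (hr : VariationBound φ r) {k k' : ℕ} (hk : 1 ≤ k) (hkk' : k ≤ k') (i : ℕ)
    (x : ∀ i, A i) : lowPot φ i k x ≤ lowPot φ i k' x := by
  have : Nonempty {y : ∀ i, A i // ∀ j, i ≤ j → j < i + k' → y j = x j} :=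
    ⟨⟨x, fun _ _ _ => rfl⟩⟩
  exact le_ciInf fun ⟨y, hy⟩ =>
    ciInf_le (bddBelow_lowPot hr hk i x) ⟨y, fun j h1 h2 => hy j h1 (by omega)⟩

end LowPot

/-! ### Uniqueness of Gibbs measures on a fibre -/

section Uniqueness

variable {A : ℕ → Type*} [∀ i, Fintype (A i)] {χ : ∀ i, A i → ℝ}
  {φ ψ : ℕ → (∀ i, A i) → ℝ} {r : ℕ → ℝ} {N : ℕ}

/-- The mean of `f` over the coordinates below `l` for the weights built from the infima of the
`φ i` over cylinders that end at `l`. It describes the configuration to the left of a renewal at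
`l`, and does not depend on the boundary condition `x` once `f` depends on the coordinates below
`l` only. -/
noncomputable def freeMean (χ : ∀ i, A i → ℝ) (φ : ℕ → (∀ i, A i) → ℝ) (f : (∀ i, A i) → ℝ)
    (x : ∀ i, A i) (l : ℕ) : ℝ :=
  blockMean χ (fun i => lowPot φ i (l - i)) l f x

theorem weight_lowPot_dependsOn {A : ℕ → Type*} (χ : ∀ i, A i → ℝ) (φ : ℕ → (∀ i, A i) → ℝ)
    (l : ℕ) :
    DependsOn (weight χ (fun i => lowPot φ i (l - i)) (Finset.range l)) (Set.Iio l) := by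
  refine weight_dependsOn (fun i hi => by simpa using hi) fun i hi => ?_
  refine (lowPot_dependsOn φ i (l - i)).mono fun j hj => ?_
  rw [Finset.mem_range] at hi
  simp only [Set.mem_Ico, Set.mem_Iio] at hj ⊢
  omega

theorem sumOver_range_congr {F : (∀ i, A i) → ℝ} {l : ℕ} (hF : DependsOn F (Set.Iio l))
    (x y : ∀ i, A i) : sumOver (Finset.range l) F x = sumOver (Finset.range l) F y := by
  refine sumOver_dependsOn hF (Finset.range l) fun i hi => ?_
  simp at hi

theorem dependsOn_mul {A : ℕ → Type*} {f g : (∀ i, A i) → ℝ} {S : Set ℕ} (hf : DependsOn f S)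
    (hg : DependsOn g S) : DependsOn (fun x => f x * g x) S := fun x y h => by
  simp only [hf h, hg h]

/-- Given a renewal at `l`, the configuration to the left of `l` is independent of the one to the
right of `l`, and its law is that of `freeMean`. -/
theorem blockMean_renewal (hχ : ∀ i a, 0 ≤ χ i a) (hχ' : ∀ i, ∃ a, 0 < χ i a)
    (hψ : ∀ i, DependsOn (ψ i) (Set.Ici i)) {f : (∀ i, A i) → ℝ} {m l : ℕ}
    (hf : DependsOn f (Set.Iio m)) (hml : m ≤ l) (hlN : l ≤ N) {a : (∀ i, A i) → ℝ}
    (ha : DependsOn a (Set.Ici l)) (x₀ z : ∀ i, A i) :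
    blockMean χ ψ N (fun x => f x *
        ((∏ i ∈ Finset.Ico 0 l, Real.exp (lowPot φ i (l - i) x - ψ i x)) * a x)) z
      = blockMean χ ψ N (fun x =>
        (∏ i ∈ Finset.Ico 0 l, Real.exp (lowPot φ i (l - i) x - ψ i x)) * a x) z
          * freeMean χ φ f x₀ l := by
  set w := weight χ (fun i => lowPot φ i (l - i)) (Finset.range l) with hw
  set G : (∀ i, A i) → ℝ := fun x => weight χ ψ (Finset.Ico l N) x * a x with hG
  have hwdep : DependsOn w (Set.Iio l) := weight_lowPot_dependsOn χ φ l
  have hGdep : DependsOn G (Set.Ici l) := by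
    refine dependsOn_mul (weight_dependsOn (fun i hi => ?_) fun i hi => ?_) ha
    · simp only [Finset.coe_Ico, Set.mem_Ico] at hi
      exact hi.1
    · exact (hψ i).mono (Set.Ici_subset_Ici.2 (Finset.mem_Ico.1 hi).1)
  have hdisj := disjoint_Ici_range l
  have hpt : ∀ x, weight χ ψ (Finset.range N) x *
      ((∏ i ∈ Finset.Ico 0 l, Real.exp (lowPot φ i (l - i) x - ψ i x)) * a x)
      = G x * w x := by
    intro x
    have h1 : weight χ ψ (Finset.range N) x
        = weight χ ψ (Finset.range l) x * weight χ ψ (Finset.Ico l N) x :=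
      (Finset.prod_range_mul_prod_Ico _ hlN).symm
    have h2 : weight χ ψ (Finset.range l) x
        * ∏ i ∈ Finset.Ico 0 l, Real.exp (lowPot φ i (l - i) x - ψ i x) = w x := by
      rw [← Finset.range_eq_Ico, hw, weight, weight, ← Finset.prod_mul_distrib]
      refine Finset.prod_congr rfl fun i _ => ?_
      rw [mul_assoc, ← Real.exp_add]
      congr 2
      ring
    rw [h1, ← h2, hG]
    ring
  have hZ : 0 < sumOver (Finset.range l) w x₀ := sumOver_weight_pos hχ hχ' _ l x₀
  have key : sumOver (Finset.range N) (fun x => G x * (w x * f x))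
      = sumOver (Finset.range N) (fun x => freeMean χ φ f x₀ l * (G x * w x)) := by
    refine sumOver_congr_of_subset (Finset.range_subset_range.2 hlN) (funext fun x => ?_)
    rw [sumOver_mul_left hGdep hdisj, sumOver_const_mul, sumOver_mul_left hGdep hdisj,
      sumOver_range_congr hwdep x x₀, sumOver_range_congr
        (dependsOn_mul hwdep (hf.mono (Set.Iio_subset_Iio hml))) x x₀, freeMean, blockMean,
      ← hw]
    field_simp
  have hL : (fun x => weight χ ψ (Finset.range N) x * (f x *
      ((∏ i ∈ Finset.Ico 0 l, Real.exp (lowPot φ i (l - i) x - ψ i x)) * a x)))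
      = fun x => G x * (w x * f x) := funext fun x => by
    rw [mul_left_comm, hpt x]
    ring
  unfold blockMean
  rw [hL, funext hpt, key, sumOver_const_mul]
  ring

/-- The mean of a local function is, up to the probability of no renewal in `S`, a mixture of the
values of `freeMean` at the last renewal in `S`. The event of no renewal in an upper part of `S`
is at most as likely as for the independent ranges with thresholds `exp (-r k)`. -/
theorem exists_mixture (hr : VariationBound φ r) (hχ : ∀ i a, 0 ≤ χ i a)
    (hχ' : ∀ i, ∃ a, 0 < χ i a) (hψ : ∀ i, DependsOn (ψ i) (Set.Ici i))
    (hlow : ∀ i k x, 1 ≤ k → i + k ≤ N →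
      lowPot φ i k x ≤ ψ i x ∧ ψ i x ≤ lowPot φ i k x + r k)
    {f : (∀ i, A i) → ℝ} {m : ℕ} (hf : DependsOn f (Set.Iio m)) (hf0 : ∀ x, 0 ≤ f x)
    (hf1 : ∀ x, f x ≤ 1) {S : Finset ℕ} (hS : ∀ l ∈ S, m ≤ l ∧ 1 ≤ l ∧ l ≤ N)
    (x₀ z : ∀ i, A i) :
    ∃ (t₀ : ℝ) (t : ℕ → ℝ), 0 ≤ t₀ ∧ (∀ l, 0 ≤ t l) ∧ t₀ + ∑ l ∈ S, t l = 1 ∧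
      ∑ l ∈ S, t l * freeMean χ φ f x₀ l ≤ blockMean χ ψ N f z ∧
      blockMean χ ψ N f z ≤ t₀ + ∑ l ∈ S, t l * freeMean χ φ f x₀ l ∧
      ∀ K, 1 - avoidProb (fun _ k => Real.exp (-r k)) 0 (S.filter (K ≤ ·))
        ≤ ∑ l ∈ S with K ≤ l, t l := by
  set c : (∀ i, A i) → ℕ → ℕ → ℝ := fun x i k => Real.exp (lowPot φ i k x - ψ i x) with hc
  -- `P l x` is the probability of a renewal at `l` and `a T l x` that of no later one in `T`.
  set a : Finset ℕ → ℕ → (∀ i, A i) → ℝ := fun T l x => avoidProb (c x) l T with ha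
  set P : ℕ → (∀ i, A i) → ℝ := fun l x => ∏ i ∈ Finset.Ico 0 l, c x i (l - i) with hP
  have hadep : ∀ T l, DependsOn (a T l) (Set.Ici l) := by
    intro T l x y hxy
    refine avoidProb_congr_left T fun i hi => funext fun k => ?_
    rw [hc]
    simp only
    rw [(lowPot_dependsOn φ i k) fun j hj => hxy j (hi.trans hj.1),
      (hψ i) fun j hj => hxy j (hi.trans hj)]
  have hcl : ∀ l ∈ S, ∀ i x, i < l → c x i (l - i) ∈ Set.Icc (0 : ℝ) 1 ∧
      Real.exp (-r (l - i)) ≤ c x i (l - i) := by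
    intro l hl i x hil
    have h := hlow i (l - i) x (by omega) (by have := hS l hl; omega)
    exact ⟨⟨(Real.exp_pos _).le, Real.exp_le_one_iff.2 (by linarith)⟩,
      Real.exp_le_exp.2 (by linarith)⟩
  have hdecomp : ∀ T ⊆ S, ∀ x, a T 0 x + ∑ l ∈ T, P l x * a T l x = 1 := by
    intro T hT x
    rw [← avoidProb_add_sum (c := c x) (l := 0) (S := T)]
    · have : T.filter (0 < ·) = T := Finset.filter_true_of_mem fun l hl => (hS l (hT hl)).2.1
      rw [this]
    · intro i k k' hk hkk'
      exact Real.exp_le_exp.2 (sub_le_sub_right (lowPot_mono hr hk hkk' i x) _)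
    · exact fun l hl i _ hil => (hcl l (hT hl) i x hil).1
  have hdom : ∀ T ⊆ S, ∀ x, a T 0 x ≤ avoidProb (fun _ k => Real.exp (-r k)) 0 T :=
    fun T hT x => avoidProb_anti fun l hl i _ hil => (hcl l (hT hl) i x hil).2
  have hP0 : ∀ l x, 0 ≤ P l x := fun l x => Finset.prod_nonneg fun i _ => (Real.exp_pos _).le
  have ha0 : ∀ T l x, 0 ≤ a T l x := fun T l x => avoidProb_nonneg _ _ _
  have hsplit : ∀ f : (∀ i, A i) → ℝ, blockMean χ ψ N f z
      = blockMean χ ψ N (fun x => f x * a S 0 x) z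
        + ∑ l ∈ S, blockMean χ ψ N (fun x => f x * (P l x * a S l x)) z := by
    intro f
    rw [← blockMean_sum, ← blockMean_add]
    congr 1
    funext x
    rw [← Finset.mul_sum, ← mul_add, hdecomp S subset_rfl, mul_one]
  have hf' : blockMean χ ψ N f z = blockMean χ ψ N (fun x => f x * a S 0 x) z
      + ∑ l ∈ S, blockMean χ ψ N (fun x => P l x * a S l x) z * freeMean χ φ f x₀ l := by
    rw [hsplit f]
    congr 1
    refine Finset.sum_congr rfl fun l hl => ?_
    exact blockMean_renewal hχ hχ' hψ hf (hS l hl).1 (hS l hl).2.2 (hadep S l) x₀ z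
  have hsum : blockMean χ ψ N (a S 0) z
      + ∑ l ∈ S, blockMean χ ψ N (fun x => P l x * a S l x) z = 1 := by
    have := hsplit fun _ => 1
    simp only [one_mul] at this
    rw [← this, blockMean_const hχ hχ']
  refine ⟨blockMean χ ψ N (a S 0) z, fun l => blockMean χ ψ N (fun x => P l x * a S l x) z,
    blockMean_nonneg hχ (ha0 S 0) z,
    fun l => blockMean_nonneg hχ (fun x => mul_nonneg (hP0 l x) (ha0 S l x)) z, hsum, ?_, ?_, ?_⟩
  · rw [hf']
    exact le_add_of_nonneg_left (blockMean_nonneg hχ (fun x => mul_nonneg (hf0 x) (ha0 S 0 x)) z)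
  · rw [hf']
    refine add_le_add_left (blockMean_mono hχ (fun x => ?_) z) _
    exact mul_le_of_le_one_left (ha0 S 0 x) (hf1 x)
  · intro K
    rw [← blockMean_sum, sub_le_iff_le_add,
      ← blockMean_const (ψ := ψ) (N := N) hχ hχ' (avoidProb _ _ _) z,
      ← blockMean_add, ← blockMean_const (ψ := ψ) (N := N) hχ hχ' 1 z]
    refine blockMean_mono hχ (fun x => ?_) z
    have hT : S.filter (K ≤ ·) ⊆ S := Finset.filter_subset _ _
    have h1 := hdecomp _ hT x
    have h2 := hdom _ hT x
    have h3 : ∑ l ∈ S with K ≤ l, P l x * a (S.filter (K ≤ ·)) l x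
        = ∑ l ∈ S with K ≤ l, P l x * a S l x := by
      refine Finset.sum_congr rfl fun l hl => ?_
      congr 1
      refine avoidProb_congr_right _ fun j hj => ?_
      rw [Finset.mem_filter] at hl ⊢
      exact ⟨fun h => h.1, fun h => ⟨h, by omega⟩⟩
    rw [h3] at h1
    linarith

end Uniqueness

section UniquenessLimit

variable {A : ℕ → Type*} [∀ i, Fintype (A i)] {χ : ∀ i, A i → ℝ}
  {φ : ℕ → (∀ i, A i) → ℝ} {r : ℕ → ℝ}

/-- The weights of `freeMean` at `N` are an admissible choice in `exists_mixture`. -/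
theorem lowPot_bounds {A : ℕ → Type*} {φ : ℕ → (∀ i, A i) → ℝ} (hr : VariationBound φ r)
    (N i k : ℕ) (x : ∀ i, A i) (hk : 1 ≤ k) (hik : i + k ≤ N) :
    lowPot φ i k x ≤ lowPot φ i (N - i) x ∧ lowPot φ i (N - i) x ≤ lowPot φ i k x + r k :=
  ⟨lowPot_mono hr hk (by omega) i x,
    (lowPot_le hr (by omega) i x).trans (le_lowPot_add hr hk i x)⟩

theorem freeMean_mem_Icc (hχ : ∀ i a, 0 ≤ χ i a) (hχ' : ∀ i, ∃ a, 0 < χ i a)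
    {f : (∀ i, A i) → ℝ} (hf0 : ∀ x, 0 ≤ f x) (hf1 : ∀ x, f x ≤ 1) (x : ∀ i, A i) (l : ℕ) :
    freeMean χ φ f x l ∈ Set.Icc (0 : ℝ) 1 :=
  ⟨blockMean_nonneg hχ hf0 x, blockMean_le_const hχ hχ' hf1 x⟩

/-- The times `l` at which `freeMean` is well below its limit superior are avoided by the
renewal set with a definite probability. -/
theorem exists_avoidProb_ge (hr : VariationBound φ r) (h0 : ∀ k, 1 ≤ k → 0 ≤ r k)
    (hanti : ∀ k k', 1 ≤ k → k ≤ k' → r k' ≤ r k)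
    (hsum : ¬ Summable fun n => Real.exp (-∑ k ∈ Finset.Icc 1 n, r k))
    (hχ : ∀ i a, 0 ≤ χ i a) (hχ' : ∀ i, ∃ a, 0 < χ i a)
    {f : (∀ i, A i) → ℝ} {m : ℕ} (hf : DependsOn f (Set.Iio m)) (hf0 : ∀ x, 0 ≤ f x)
    (hf1 : ∀ x, f x ≤ 1) (x₀ : ∀ i, A i) {δ : ℝ} (hδ : 0 < δ) :
    ∃ M, ∀ N, 3 / 4 ≤ avoidProb (fun _ k => Real.exp (-r k)) 0
      ((Finset.Icc M N).filter fun l =>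
        freeMean χ φ f x₀ l < limsup (freeMean χ φ f x₀) atTop - δ) := by
  set h := freeMean χ φ f x₀ with hh
  set s := limsup h atTop with hs
  have hh01 : ∀ l, h l ∈ Set.Icc (0 : ℝ) 1 := freeMean_mem_Icc hχ hχ' hf0 hf1 x₀
  have hbd : IsBoundedUnder (· ≤ ·) atTop h := isBoundedUnder_of ⟨1, fun l => (hh01 l).2⟩
  have hbd' : IsCoboundedUnder (· ≤ ·) atTop h :=
    IsBoundedUnder.isCoboundedUnder_le (isBoundedUnder_of ⟨0, fun l => (hh01 l).1⟩)
  have hε : 0 < δ / 16 := by positivity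
  have hup : ∀ᶠ l in atTop, h l < s + δ / 16 :=
    eventually_lt_of_limsup_lt (lt_add_of_pos_right _ hε) hbd
  have hfreq : ∃ᶠ l in atTop, s - δ / 16 < h l :=
    frequently_lt_of_lt_limsup hbd' (sub_lt_self _ hε)
  obtain ⟨M, hM⟩ := eventually_atTop.1 (hup.and (eventually_ge_atTop (m + 1)))
  have hs0 : 0 ≤ s + δ / 16 := (hh01 M).1.trans (hM M le_rfl).1.le
  obtain ⟨M₁, hM₁, hMM₁⟩ := (((tendsto_avoidProb_Icc h0 hanti hsum M).eventually
    (gt_mem_nhds (show (0 : ℝ) < δ / 8 by positivity))).and (eventually_ge_atTop M)).exists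
  refine ⟨M₁ + 1, fun N => ?_⟩
  -- `freeMean` at `N'` nearly attains the limit superior, and it is a mixture of the values of
  -- `freeMean` over `S`. The part `[M, M₁]` of `S` makes avoiding `S` unlikely. As no value over
  -- `S` is much above the limit superior, the values over `bad` have a small weight.
  obtain ⟨N', hN', hN's⟩ := frequently_atTop.1 hfreq (max N (M₁ + 1))
  set bad : Finset ℕ := (Finset.Icc (M₁ + 1) N').filter fun l => h l < s - δ with hbad
  set S : Finset ℕ := Finset.Icc M M₁ ∪ bad with hS
  have hSmem : ∀ l ∈ S, M ≤ l ∧ l ≤ N' := by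
    intro l hl
    simp only [hS, hbad, Finset.mem_union, Finset.mem_Icc, Finset.mem_filter] at hl
    have := le_max_right N (M₁ + 1)
    omega
  obtain ⟨t₀, t, ht0, ht, htsum, -, hle, hK⟩ := exists_mixture (N := N')
    (ψ := fun i => lowPot φ i (N' - i)) hr hχ hχ'
    (fun i => (lowPot_dependsOn φ i _).mono fun j hj => hj.1)
    (fun i k x hk hik => lowPot_bounds hr N' i k x hk hik) hf hf0 hf1 (S := S)
    (fun l hl => by have := hSmem l hl; have := (hM l this.1).2; omega) x₀ x₀
  have hle' : h N' ≤ t₀ + ∑ l ∈ S, t l * h l := hle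
  have hSK : S.filter (M₁ + 1 ≤ ·) = bad := by
    ext l
    simp only [hS, hbad, Finset.mem_union, Finset.mem_Icc, Finset.mem_filter]
    constructor
    · rintro ⟨h1 | h1, h2⟩
      · omega
      · exact h1
    · exact fun h1 => ⟨.inr h1, h1.1.1⟩
  have hK1 := hK (M₁ + 1)
  rw [hSK] at hK1
  have ht0' : t₀ ≤ δ / 8 := by
    have h1 := hK 0
    have h2 : S.filter (0 ≤ ·) = S := Finset.filter_true_of_mem fun _ _ => Nat.zero_le _
    rw [h2] at h1
    have h3 : avoidProb (fun _ k => Real.exp (-r k)) 0 S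
        ≤ avoidProb (fun _ k => Real.exp (-r k)) 0 (Finset.Icc M M₁) :=
      avoidProb_anti_right _ fun j hj _ => Finset.mem_union_left _ hj
    linarith
  have hb : ∑ l ∈ bad, t l ≤ 1 / 4 := by
    have h1 := Finset.sum_filter_add_sum_filter_not S (M₁ + 1 ≤ ·) t
    have h2 := Finset.sum_filter_add_sum_filter_not S (M₁ + 1 ≤ ·) fun l => t l * h l
    rw [hSK] at h1 h2
    have h3 : ∑ l ∈ bad, t l * h l ≤ (s - δ) * ∑ l ∈ bad, t l := by
      rw [Finset.mul_sum]
      refine Finset.sum_le_sum fun l hl => ?_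
      rw [mul_comm]
      exact mul_le_mul_of_nonneg_right (Finset.mem_filter.1 hl).2.le (ht l)
    have h4 : ∑ l ∈ S with ¬ M₁ + 1 ≤ l, t l * h l
        ≤ (s + δ / 16) * ∑ l ∈ S with ¬ M₁ + 1 ≤ l, t l := by
      rw [Finset.mul_sum]
      refine Finset.sum_le_sum fun l hl => ?_
      rw [mul_comm]
      exact mul_le_mul_of_nonneg_right (hM l (hSmem l (Finset.mem_filter.1 hl).1).1).1.le (ht l)
    have h5 : ∑ l ∈ S with ¬ M₁ + 1 ≤ l, t l = 1 - t₀ - ∑ l ∈ bad, t l := by linarith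
    rw [h5] at h4
    have h6 : 0 ≤ ∑ l ∈ bad, t l := Finset.sum_nonneg fun l _ => ht l
    have h7 : 0 ≤ (s + δ / 16) * t₀ := mul_nonneg hs0 ht0
    -- Summing up, `δ * ∑ t l ≤ δ / 8 + t₀ ≤ δ / 4`.
    have h8 : δ * ∑ l ∈ bad, t l ≤ δ * (1 / 4) := by nlinarith
    exact le_of_mul_le_mul_left h8 hδ
  have hmon : avoidProb (fun _ k => Real.exp (-r k)) 0 bad
      ≤ avoidProb (fun _ k => Real.exp (-r k)) 0
        ((Finset.Icc (M₁ + 1) N).filter fun l => h l < s - δ) :=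
    avoidProb_anti_right _ fun j hj _ => by
      rw [Finset.mem_filter, Finset.mem_Icc] at hj
      exact Finset.mem_filter.2 ⟨Finset.mem_Icc.2
        ⟨hj.1.1, hj.1.2.trans ((le_max_left _ _).trans hN')⟩, hj.2⟩
  linarith

/-- The limit superior and the limit inferior of `freeMean` coincide: otherwise the renewal set,
which visits every long interval, would avoid two sets that cover such an interval. -/
theorem exists_tendsto_freeMean (hr : VariationBound φ r) (h0 : ∀ k, 1 ≤ k → 0 ≤ r k)
    (hanti : ∀ k k', 1 ≤ k → k ≤ k' → r k' ≤ r k)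
    (hsum : ¬ Summable fun n => Real.exp (-∑ k ∈ Finset.Icc 1 n, r k))
    (hχ : ∀ i a, 0 ≤ χ i a) (hχ' : ∀ i, ∃ a, 0 < χ i a)
    {f : (∀ i, A i) → ℝ} {m : ℕ} (hf : DependsOn f (Set.Iio m)) (hf0 : ∀ x, 0 ≤ f x)
    (hf1 : ∀ x, f x ≤ 1) (x₀ : ∀ i, A i) :
    ∃ s, Tendsto (freeMean χ φ f x₀) atTop (𝓝 s) := by
  set h := freeMean χ φ f x₀ with hh
  have hg : ∀ l, freeMean χ φ (fun x => 1 + -1 * f x) x₀ l = 1 + -1 * h l := fun l => by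
    rw [hh, freeMean, blockMean_add, blockMean_const hχ hχ', blockMean_const_mul, freeMean]
  set h' := freeMean χ φ (fun x => 1 + -1 * f x) x₀ with hh'
  set s := limsup h atTop with hs
  set s' := limsup h' atTop with hs'
  have hh01 : ∀ l, h l ∈ Set.Icc (0 : ℝ) 1 := freeMean_mem_Icc hχ hχ' hf0 hf1 x₀
  have hbd : IsBoundedUnder (· ≤ ·) atTop h := isBoundedUnder_of ⟨1, fun l => (hh01 l).2⟩
  have hbd' : IsBoundedUnder (· ≤ ·) atTop h' :=
    isBoundedUnder_of ⟨1, fun l => by rw [hg]; linarith [(hh01 l).1]⟩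
  -- Here `1 - s'` is the limit inferior of `h`.
  have hss : s + s' ≤ 1 := by
    by_contra! hcon
    have hδ : 0 < (s + s' - 1) / 3 := by linarith
    obtain ⟨M, hM⟩ := exists_avoidProb_ge hr h0 hanti hsum hχ hχ' hf hf0 hf1 x₀ hδ
    obtain ⟨M', hM'⟩ := exists_avoidProb_ge (m := m) (f := fun x => 1 + -1 * f x) hr h0 hanti
      hsum hχ hχ'
      (fun x y hxy => by simp only [hf hxy]) (fun x => by linarith [hf1 x])
      (fun x => by linarith [hf0 x]) x₀ hδ
    obtain ⟨N, hN⟩ := ((tendsto_avoidProb_Icc h0 hanti hsum (max M M')).eventually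
      (gt_mem_nhds (show (0 : ℝ) < 1 / 4 by norm_num))).exists
    have h1 := hM N
    have h2 := hM' N
    have h3 := avoidProb_add_le (fun _ k => Real.exp (-r k)) 0
      ((Finset.Icc M N).filter fun l => h l < s - (s + s' - 1) / 3)
      ((Finset.Icc M' N).filter fun l => h' l < s' - (s + s' - 1) / 3)
    have h4 : avoidProb (fun _ k => Real.exp (-r k)) 0
        ((Finset.Icc M N).filter (fun l => h l < s - (s + s' - 1) / 3) ∪
          (Finset.Icc M' N).filter fun l => h' l < s' - (s + s' - 1) / 3)
        ≤ avoidProb (fun _ k => Real.exp (-r k)) 0 (Finset.Icc (max M M') N) := by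
      refine avoidProb_anti_right _ fun j hj _ => ?_
      rw [Finset.mem_Icc, max_le_iff] at hj
      rw [Finset.mem_union, Finset.mem_filter, Finset.mem_filter, Finset.mem_Icc, Finset.mem_Icc,
        hg]
      rcases lt_or_ge (h j) (s - (s + s' - 1) / 3) with hlt | hge
      · exact .inl ⟨⟨hj.1.1, hj.2⟩, hlt⟩
      · exact .inr ⟨⟨hj.1.2, hj.2⟩, by linarith⟩
    linarith
  refine ⟨s, Metric.tendsto_atTop'.2 fun ε hε => ?_⟩
  have e1 : ∀ᶠ l in atTop, h l < s + ε :=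
    eventually_lt_of_limsup_lt (lt_add_of_pos_right _ hε) hbd
  have e2 : ∀ᶠ l in atTop, h' l < s' + ε :=
    eventually_lt_of_limsup_lt (lt_add_of_pos_right _ hε) hbd'
  obtain ⟨M, hM⟩ := eventually_atTop.1 (e1.and e2)
  refine ⟨M, fun l hl => ?_⟩
  have h1 := hM l hl.le
  rw [hg] at h1
  rw [Real.dist_eq, abs_lt]
  constructor <;> linarith [h1.1, h1.2]

/-- For local functions the block means converge, uniformly in the boundary condition. -/
theorem exists_blockMean_sub_le (hr : VariationBound φ r) (h0 : ∀ k, 1 ≤ k → 0 ≤ r k)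
    (hanti : ∀ k k', 1 ≤ k → k ≤ k' → r k' ≤ r k)
    (hsum : ¬ Summable fun n => Real.exp (-∑ k ∈ Finset.Icc 1 n, r k))
    (hφ : ∀ n, DependsOn (φ n) (Set.Ici n))
    (hχ : ∀ i a, 0 ≤ χ i a) (hχ' : ∀ i, ∃ a, 0 < χ i a)
    {f : (∀ i, A i) → ℝ} {m : ℕ} (hf : DependsOn f (Set.Iio m)) (hf0 : ∀ x, 0 ≤ f x)
    (hf1 : ∀ x, f x ≤ 1) :
    ∀ ε > 0, ∃ N, ∀ x x', blockMean χ φ N f x - blockMean χ φ N f x' ≤ ε := by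
  intro ε hε
  rcases isEmpty_or_nonempty (∀ i, A i) with hA | ⟨⟨x₀⟩⟩
  · exact ⟨0, fun x => hA.elim x⟩
  obtain ⟨s, hs⟩ := exists_tendsto_freeMean hr h0 hanti hsum hχ hχ' hf hf0 hf1 x₀
  set h := freeMean χ φ f x₀ with hh
  have hh01 : ∀ l, h l ∈ Set.Icc (0 : ℝ) 1 := freeMean_mem_Icc hχ hχ' hf0 hf1 x₀
  have hs01 : s ∈ Set.Icc (0 : ℝ) 1 := isClosed_Icc.mem_of_tendsto hs (.of_forall hh01)
  have hε' : 0 < ε / 8 := by positivity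
  obtain ⟨M, hM⟩ := eventually_atTop.1
    ((hs.eventually (Metric.ball_mem_nhds s hε')).and (eventually_ge_atTop (m + 1)))
  obtain ⟨N, hN, hMN⟩ := (((tendsto_avoidProb_Icc h0 hanti hsum M).eventually
    (gt_mem_nhds hε')).and (eventually_ge_atTop M)).exists
  have key : ∀ z, |blockMean χ φ N f z - s| ≤ ε / 2 := by
    intro z
    obtain ⟨t₀, t, ht0, ht, htsum, hge, hle, hK⟩ := exists_mixture (N := N) (ψ := φ) hr hχ hχ' hφ
      (fun i k x hk _ => ⟨lowPot_le hr hk i x, le_lowPot_add hr hk i x⟩) hf hf0 hf1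
      (S := Finset.Icc M N)
      (fun l hl => by
        rw [Finset.mem_Icc] at hl
        have := (hM l hl.1).2
        omega) x₀ z
    have ht0' : t₀ ≤ ε / 8 := by
      have h1 := hK 0
      have h2 : (Finset.Icc M N).filter (0 ≤ ·) = Finset.Icc M N :=
        Finset.filter_true_of_mem fun _ _ => Nat.zero_le _
      rw [h2] at h1
      linarith
    have hclose : ∀ l ∈ Finset.Icc M N, s - ε / 8 ≤ h l ∧ h l ≤ s + ε / 8 := by
      intro l hl
      have h1 := (hM l (Finset.mem_Icc.1 hl).1).1
      rw [Real.dist_eq, abs_lt] at h1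
      constructor <;> linarith [h1.1, h1.2]
    have hS : ∑ l ∈ Finset.Icc M N, t l = 1 - t₀ := by linarith
    have h1 : ∑ l ∈ Finset.Icc M N, t l * h l ≤ (1 - t₀) * (s + ε / 8) := by
      rw [← hS, Finset.sum_mul]
      exact Finset.sum_le_sum fun l hl => mul_le_mul_of_nonneg_left (hclose l hl).2 (ht l)
    have h2 : (1 - t₀) * (s - ε / 8) ≤ ∑ l ∈ Finset.Icc M N, t l * h l := by
      rw [← hS, Finset.sum_mul]
      exact Finset.sum_le_sum fun l hl => mul_le_mul_of_nonneg_left (hclose l hl).1 (ht l)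
    have h3 : 0 ≤ t₀ * s := mul_nonneg ht0 hs01.1
    have h4 : t₀ * s ≤ t₀ := mul_le_of_le_one_right ht0 hs01.2
    have h5 : 0 ≤ t₀ * (ε / 8) := by positivity
    rw [abs_le]
    constructor <;> nlinarith
  refine ⟨N, fun x x' => ?_⟩
  have h1 := abs_le.1 (key x)
  have h2 := abs_le.1 (key x')
  linarith [h1.2, h2.1]

end UniquenessLimit

/-! ### Means over fibres and their uniform convergence -/

/-- The variations of the potentials are bounded by a sequence satisfying Berbee's condition. -/
structure BerbeeBound {A : ℕ → Type*} (φ : ℕ → (∀ i, A i) → ℝ) (r : ℕ → ℝ) : Prop where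
  variation : VariationBound φ r
  nonneg : ∀ k, 1 ≤ k → 0 ≤ r k
  anti : ∀ k k', 1 ≤ k → k ≤ k' → r k' ≤ r k
  not_summable : ¬ Summable fun n => Real.exp (-∑ k ∈ Finset.Icc 1 n, r k)

section Dependence

variable {A : ℕ → Type*} [∀ i, Fintype (A i)] {χ : ∀ i, A i → ℝ}
  {φ : ℕ → (∀ i, A i) → ℝ}

theorem blockMean_dependsOn (χ : ∀ i, A i → ℝ) (φ : ℕ → (∀ i, A i) → ℝ) (N : ℕ)
    (f : (∀ i, A i) → ℝ) : DependsOn (blockMean χ φ N f) (Set.Ici N) := by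
  intro x y hxy
  have h : ∀ i ∈ Set.univ \ (Finset.range N : Set ℕ), x i = y i := fun i hi => hxy i (by
    simpa using hi)
  unfold blockMean
  rw [sumOver_dependsOn (dependsOn_univ _) _ h, sumOver_dependsOn (dependsOn_univ _) _ h]

/-- Consistency of the block means. -/
theorem blockMean_blockMean (hχ : ∀ i a, 0 ≤ χ i a) (hχ' : ∀ i, ∃ a, 0 < χ i a)
    (hφ : ∀ n, DependsOn (φ n) (Set.Ici n)) {N N' : ℕ} (h : N ≤ N') (f : (∀ i, A i) → ℝ)
    (x : ∀ i, A i) :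
    blockMean χ φ N' (blockMean χ φ N f) x = blockMean χ φ N' f x := by
  have hrest : DependsOn (weight χ φ (Finset.Ico N N')) (Set.Ici N) := by
    refine weight_dependsOn (fun i hi => ?_) fun i hi => ?_
    · simp only [Finset.coe_Ico, Set.mem_Ico] at hi
      exact hi.1
    · exact (hφ i).mono (Set.Ici_subset_Ici.2 (Finset.mem_Ico.1 hi).1)
  have hdisj := disjoint_Ici_range N
  have hw : ∀ x, weight χ φ (Finset.range N') x
      = weight χ φ (Finset.Ico N N') x * weight χ φ (Finset.range N) x := fun x => by
    rw [mul_comm]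
    exact (Finset.prod_range_mul_prod_Ico _ h).symm
  have key : sumOver (Finset.range N') (fun x => weight χ φ (Finset.range N') x *
      blockMean χ φ N f x) = sumOver (Finset.range N') (fun x => weight χ φ (Finset.range N') x *
      f x) := by
    refine sumOver_congr_of_subset (Finset.range_subset_range.2 h) (funext fun x => ?_)
    have hZ := sumOver_weight_pos hχ hχ' φ N x
    simp only [hw, mul_assoc]
    rw [sumOver_mul_left hrest hdisj, sumOver_mul_left hrest hdisj]
    congr 1
    simp only [mul_comm (weight χ φ (Finset.range N) _) (blockMean χ φ N f _)]
    rw [sumOver_mul_left (blockMean_dependsOn χ φ N f) hdisj, blockMean]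
    field_simp
  rw [blockMean, key, blockMean]

theorem blockMean_sub_le_of_le (hχ : ∀ i a, 0 ≤ χ i a) (hχ' : ∀ i, ∃ a, 0 < χ i a)
    (hφ : ∀ n, DependsOn (φ n) (Set.Ici n)) {N N' : ℕ} (h : N ≤ N') {f : (∀ i, A i) → ℝ} {ε : ℝ}
    (hε : ∀ x x', blockMean χ φ N f x - blockMean χ φ N f x' ≤ ε) (x x' : ∀ i, A i) :
    blockMean χ φ N' f x - blockMean χ φ N f x' ≤ ε := by
  rw [← blockMean_blockMean hχ hχ' hφ h f x, sub_le_iff_le_add]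
  exact blockMean_le_const hχ hχ' (fun y => sub_le_iff_le_add.1 (hε y x')) x

theorem sub_blockMean_le_of_le (hχ : ∀ i a, 0 ≤ χ i a) (hχ' : ∀ i, ∃ a, 0 < χ i a)
    (hφ : ∀ n, DependsOn (φ n) (Set.Ici n)) {N N' : ℕ} (h : N ≤ N') {f : (∀ i, A i) → ℝ} {c ε : ℝ}
    (hε : ∀ x', c - blockMean χ φ N f x' ≤ ε) (x' : ∀ i, A i) :
    c - blockMean χ φ N' f x' ≤ ε := by
  rw [← blockMean_blockMean hχ hχ' hφ h f x', sub_le_comm]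
  rw [← blockMean_const (ψ := φ) (N := N') hχ hχ' (c - ε) x']
  exact blockMean_mono hχ (fun y => sub_le_comm.1 (hε y)) x'

end Dependence

section Continuity

variable {A : ℕ → Type*} [∀ i, Fintype (A i)] [∀ i, TopologicalSpace (A i)]
    [∀ i, DiscreteTopology (A i)]

/-- A continuous function on the symbolic space is nearly determined by finitely many
coordinates. -/
theorem exists_forall_abs_sub_le {f : (∀ i, A i) → ℝ} (hf : Continuous f) {ε : ℝ} (hε : 0 < ε) :
    ∃ m, ∀ x y, (∀ i < m, x i = y i) → |f x - f y| ≤ ε := by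
  by_contra! hcon
  set K : ℕ → Set ((∀ i, A i) × (∀ i, A i)) :=
    fun m => {p | (∀ i < m, p.1 i = p.2 i) ∧ ε ≤ |f p.1 - f p.2|} with hK
  have hclosed : ∀ m, IsClosed (K m) := by
    intro m
    have h2 : IsClosed {p : (∀ i, A i) × (∀ i, A i) | ε ≤ |f p.1 - f p.2|} :=
      isClosed_le continuous_const ((hf.comp continuous_fst).sub (hf.comp continuous_snd)).abs
    have h1 : {p : (∀ i, A i) × (∀ i, A i) | ∀ i < m, p.1 i = p.2 i}
        = ⋂ i, ⋂ _ : i < m, {p | p.1 i = p.2 i} := by ext; simp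
    have h3 : K m = (⋂ i, ⋂ _ : i < m, {p | p.1 i = p.2 i}) ∩
        {p | ε ≤ |f p.1 - f p.2|} := by rw [← h1]; rfl
    rw [h3]
    refine IsClosed.inter ?_ h2
    exact isClosed_iInter fun i => isClosed_iInter fun _ => isClosed_eq
      ((continuous_apply i).comp continuous_fst) ((continuous_apply i).comp continuous_snd)
  obtain ⟨⟨x, y⟩, hxy⟩ := IsCompact.nonempty_iInter_of_sequence_nonempty_isCompact_isClosed K
    (fun m p hp => ⟨fun i hi => hp.1 i (by omega), hp.2⟩)
    (fun m => by
      obtain ⟨x, y, h1, h2⟩ := hcon m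
      exact ⟨(x, y), h1, h2.le⟩)
    (hclosed 0).isCompact hclosed
  rw [Set.mem_iInter] at hxy
  have : x = y := funext fun i => (hxy (i + 1)).1 i (Nat.lt_succ_self i)
  have h := (hxy 0).2
  simp only [this, sub_self, abs_zero] at h
  linarith

/-- The block means of a continuous function have small oscillation in the boundary condition. -/
theorem exists_blockMean_sub_le_of_continuous {φ : ℕ → (∀ i, A i) → ℝ} {r : ℕ → ℝ}
    (hr : BerbeeBound φ r) (hφ : ∀ n, DependsOn (φ n) (Set.Ici n))
    {χ : ∀ i, A i → ℝ} (hχ : ∀ i a, 0 ≤ χ i a) (hχ' : ∀ i, ∃ a, 0 < χ i a)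
    {f : (∀ i, A i) → ℝ} (hf : Continuous f) {ε : ℝ} (hε : 0 < ε) :
    ∃ N, ∀ x x', blockMean χ φ N f x - blockMean χ φ N f x' ≤ ε := by
  rcases isEmpty_or_nonempty (∀ i, A i) with hA | ⟨⟨x₀⟩⟩
  · exact ⟨0, fun x => hA.elim x⟩
  obtain ⟨C, hC⟩ := (isCompact_range hf).isBounded.exists_norm_le
  set D : ℝ := max C 1 with hD
  have hD0 : 0 < D := lt_of_lt_of_le one_pos (le_max_right _ _)
  have hfD : ∀ x, |f x| ≤ D := fun x => (hC _ ⟨x, rfl⟩).trans (le_max_left _ _)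
  obtain ⟨m, hm⟩ := exists_forall_abs_sub_le hf (show 0 < ε / 4 by positivity)
  -- The local approximation of `f`, rescaled to have values in `[0, 1]`.
  set g : (∀ i, A i) → ℝ := fun x => (f (fun i => if i < m then x i else x₀ i) + D) / (2 * D)
    with hg
  have hgdep : DependsOn g (Set.Iio m) := by
    intro x y hxy
    have : (fun i => if i < m then x i else x₀ i) = fun i => if i < m then y i else x₀ i := by
      funext i
      split_ifs with hi
      · exact hxy i hi
      · rfl
    simp only [hg, this]
  obtain ⟨N, hN⟩ := exists_blockMean_sub_le hr.variation hr.nonneg hr.anti hr.not_summable hφ hχ hχ'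
    hgdep (fun x => div_nonneg
      (by linarith [(abs_le.1 (hfD fun i => if i < m then x i else x₀ i)).1]) (by positivity))
    (fun x => div_le_one_of_le₀
      (by linarith [(abs_le.1 (hfD fun i => if i < m then x i else x₀ i)).2]) (by positivity))
    (ε / (4 * D)) (by positivity)
  have hfg : ∀ x, |f x - (2 * D * g x + -D)| ≤ ε / 4 := by
    intro x
    have h1 : 2 * D * g x + -D = f fun i => if i < m then x i else x₀ i := by
      simp only [hg]
      field_simp
      ring
    rw [h1]
    exact hm _ _ fun i hi => by simp [hi]
  have hmean : ∀ x, blockMean χ φ N (fun x => 2 * D * g x + -D) x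
      = 2 * D * blockMean χ φ N g x + -D := fun x => by
    rw [blockMean_add, blockMean_const_mul, blockMean_const hχ hχ']
  have hup : ∀ x, blockMean χ φ N f x ≤ 2 * D * blockMean χ φ N g x + -D + ε / 4 := fun x => by
    rw [← hmean, ← blockMean_const (ψ := φ) (N := N) hχ hχ' (ε / 4) x, ← blockMean_add]
    exact blockMean_mono hχ (fun y => by linarith [(abs_le.1 (hfg y)).2]) x
  have hdown : ∀ x, 2 * D * blockMean χ φ N g x + -D ≤ blockMean χ φ N f x + ε / 4 := fun x => by
    rw [← hmean, ← blockMean_const (ψ := φ) (N := N) hχ hχ' (ε / 4) x, ← blockMean_add]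
    exact blockMean_mono hχ (fun y => by linarith [(abs_le.1 (hfg y)).1]) x
  refine ⟨N, fun x x' => ?_⟩
  have h1 := hup x
  have h2 := hdown x'
  have h3 := mul_le_mul_of_nonneg_left (hN x x') (show 0 ≤ 2 * D by positivity)
  have h4 : 2 * D * (ε / (4 * D)) = ε / 2 := by
    field_simp
    norm_num
  linarith

end Continuity

/-- By compactness, a small oscillation of `F z` persists for nearby `z`. -/
theorem isOpen_setOf_forall_sub_lt {X : Type*} [TopologicalSpace X] [CompactSpace X] [T2Space X]
    {F : X → X → ℝ} (hF : Continuous fun p : X × X => F p.1 p.2) (ε : ℝ) :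
    IsOpen {z | ∀ x x', F z x - F z x' < ε} := by
  have h1 : Continuous fun p : X × X × X => F p.1 p.2.1 :=
    hF.comp (continuous_fst.prodMk (continuous_fst.comp continuous_snd))
  have h2 : Continuous fun p : X × X × X => F p.1 p.2.2 :=
    hF.comp (continuous_fst.prodMk (continuous_snd.comp continuous_snd))
  have hcl : IsClosed (Prod.fst '' {p : X × X × X | ε ≤ F p.1 p.2.1 - F p.1 p.2.2}) :=
    ((isClosed_le continuous_const (h1.sub h2)).isCompact.image continuous_fst).isClosed
  rw [← isClosed_compl_iff]
  convert hcl using 1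
  ext z
  simp only [Set.mem_compl_iff, Set.mem_ofPred_eq, Set.mem_image, not_forall, not_lt]
  constructor
  · rintro ⟨x, x', h⟩
    exact ⟨(z, x, x'), h, rfl⟩
  · rintro ⟨⟨z', x, x'⟩, h, rfl⟩
    exact ⟨x, x', h⟩

section Fibre

variable {A : ℕ → Type*}

open Classical in
/-- The indicator function of the symbols that are equivalent to the symbols of `z`. -/
noncomputable def fibreInd (s : ∀ i, Setoid (A i)) (z : ∀ i, A i) (i : ℕ) (a : A i) : ℝ :=
  if s i a (z i) then 1 else 0

theorem fibreInd_nonneg (s : ∀ i, Setoid (A i)) (z : ∀ i, A i) (i : ℕ) (a : A i) :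
    0 ≤ fibreInd s z i a := by
  unfold fibreInd
  split_ifs <;> norm_num

theorem exists_fibreInd_pos (s : ∀ i, Setoid (A i)) (z : ∀ i, A i) (i : ℕ) :
    ∃ a, 0 < fibreInd s z i a :=
  ⟨z i, by simp [fibreInd]⟩

theorem fibreInd_congr {s : ∀ i, Setoid (A i)} {z z' : ∀ i, A i} (h : ∀ i, s i (z i) (z' i)) :
    fibreInd s z = fibreInd s z' := by
  classical
  funext i a
  unfold fibreInd
  have : s i a (z i) ↔ s i a (z' i) :=
    ⟨fun h' => (s i).trans h' (h i), fun h' => (s i).trans h' ((s i).symm (h i))⟩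
  split_ifs <;> first | rfl | tauto

variable [∀ i, Fintype (A i)] [∀ i, TopologicalSpace (A i)] [∀ i, DiscreteTopology (A i)]
  {φ : ℕ → (∀ i, A i) → ℝ}

theorem continuous_blockMean_fibreInd (s : ∀ i, Setoid (A i)) (hφ : ∀ n, Continuous (φ n)) (N : ℕ)
    {f : (∀ i, A i) → ℝ} (hf : Continuous f) :
    Continuous fun p : (∀ i, A i) × (∀ i, A i) => blockMean (fibreInd s p.1) φ N f p.2 := by
  have hw : ∀ n, Continuous fun p : (∀ i, A i) × (∀ i, A i) =>
      weight (fibreInd s p.1) φ (Finset.range n) p.2 := by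
    intro n
    refine continuous_finsetProd _ fun i _ => Continuous.mul ?_
      (Real.continuous_exp.comp ((hφ i).comp continuous_snd))
    have h : Continuous fun q : A i × A i => open Classical in if s i q.2 q.1 then (1 : ℝ) else 0 :=
      continuous_of_discreteTopology
    exact h.comp (((continuous_apply i).comp continuous_fst).prodMk
      ((continuous_apply i).comp continuous_snd))
  have hu : ∀ a : (∀ i : Finset.range N, A i), Continuous fun p : (∀ i, A i) × (∀ i, A i) =>
      (p.1, Function.updateFinset p.2 (Finset.range N) a) := fun a =>
    continuous_fst.prodMk ((continuous_updateFinset_left _ a).comp continuous_snd)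
  refine Continuous.div ?_ ?_ fun p =>
    (sumOver_weight_pos (fibreInd_nonneg s p.1) (exists_fibreInd_pos s p.1) φ N p.2).ne'
  · exact continuous_finsetSum _ fun a _ =>
      ((hw N).comp (hu a)).mul (hf.comp (continuous_snd.comp (hu a)))
  · exact continuous_finsetSum _ fun a _ => (hw N).comp (hu a)

/-- Uniform convergence of the fibre means, in the fibre as well as in the boundary condition. -/
theorem exists_fibreMean_sub_le {r : ℕ → ℝ} (hr : BerbeeBound φ r)
    (hφ : IsOnePointPotential φ) (s : ∀ i, Setoid (A i)) {f : (∀ i, A i) → ℝ} (hf : Continuous f)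
    {ε : ℝ} (hε : 0 < ε) :
    ∃ N, ∀ z x x', blockMean (fibreInd s z) φ N f x - blockMean (fibreInd s z) φ N f x' ≤ ε := by
  set U : ℕ → Set (∀ i, A i) := fun N => {z | ∀ x x',
    blockMean (fibreInd s z) φ N f x - blockMean (fibreInd s z) φ N f x' < ε} with hU
  have hopen : ∀ N, IsOpen (U N) :=
    fun N => isOpen_setOf_forall_sub_lt (continuous_blockMean_fibreInd s hφ.continuous N hf) ε
  obtain ⟨t, ht⟩ := isCompact_univ.elim_finite_subcover U hopen fun z _ => by
    obtain ⟨N, hN⟩ := exists_blockMean_sub_le_of_continuous hr hφ.dependsOn (fibreInd_nonneg s z)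
      (exists_fibreInd_pos s z) hf (half_pos hε)
    exact Set.mem_iUnion.2 ⟨N, fun x x' => (hN x x').trans_lt (half_lt_self hε)⟩
  refine ⟨t.sup id, fun z => ?_⟩
  obtain ⟨N, hN, hz⟩ := Set.mem_iUnion₂.1 (ht (Set.mem_univ z))
  have hle : N ≤ t.sup id := Finset.le_sup (f := id) hN
  intro x x'
  have h1 : ∀ x',
      blockMean (fibreInd s z) φ (t.sup id) f x - blockMean (fibreInd s z) φ N f x' ≤ ε :=
    blockMean_sub_le_of_le (fibreInd_nonneg s z) (exists_fibreInd_pos s z) hφ.dependsOn hle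
      (fun x x' => (hz x x').le) x
  exact sub_blockMean_le_of_le (fibreInd_nonneg s z) (exists_fibreInd_pos s z) hφ.dependsOn hle
    h1 x'

end Fibre

/-! ### The conditional laws on the fibres -/

section FibreLaw

variable {A : ℕ → Type*} [∀ i, Fintype (A i)] [∀ i, TopologicalSpace (A i)]
    [∀ i, DiscreteTopology (A i)] [∀ i, MeasurableSpace (A i)] [∀ i, BorelSpace (A i)]
    {φ : ℕ → (∀ i, A i) → ℝ}

theorem integrable_of_continuous {X : Type*} [TopologicalSpace X] [CompactSpace X]
    [MeasurableSpace X] [OpensMeasurableSpace X] (μ : Measure X) [IsFiniteMeasure μ] {f : X → ℝ}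
    (hf : Continuous f) : Integrable f μ :=
  hf.integrable_of_hasCompactSupport (HasCompactSupport.of_compactSpace f)

/-- The block mean is the integral against a probability measure with finite support. -/
theorem exists_integral_eq_blockMean {χ : ∀ i, A i → ℝ} (hχ : ∀ i a, 0 ≤ χ i a)
    (hχ' : ∀ i, ∃ a, 0 < χ i a) (φ : ℕ → (∀ i, A i) → ℝ) (N : ℕ) (x : ∀ i, A i) :
    ∃ ν : ProbabilityMeasure (∀ i, A i), ∀ f : (∀ i, A i) → ℝ, Continuous f →
      ∫ y, f y ∂(ν : Measure (∀ i, A i)) = blockMean χ φ N f x := by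
  set w : (∀ i : Finset.range N, A i) → ℝ := fun a =>
    weight χ φ (Finset.range N) (Function.updateFinset x (Finset.range N) a)
      / sumOver (Finset.range N) (weight χ φ (Finset.range N)) x with hw
  have hZ := sumOver_weight_pos hχ hχ' φ N x
  have hw0 : ∀ a, 0 ≤ w a := fun a => div_nonneg (weight_nonneg hχ φ _ _) hZ.le
  have hw1 : ∑ a, w a = 1 := by
    rw [hw, ← Finset.sum_div]
    exact div_self hZ.ne'
  set ν : Measure (∀ i, A i) := ∑ a, ENNReal.ofReal (w a) •
    Measure.dirac (Function.updateFinset x (Finset.range N) a) with hν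
  have hprob : IsProbabilityMeasure ν := by
    constructor
    simp only [hν, Measure.coe_finsetSum, Finset.sum_apply, Measure.smul_apply, smul_eq_mul,
      measure_univ, mul_one]
    rw [← ENNReal.ofReal_sum_of_nonneg fun a _ => hw0 a, hw1, ENNReal.ofReal_one]
  refine ⟨⟨ν, hprob⟩, fun f hf => ?_⟩
  change ∫ y, f y ∂ν = _
  rw [hν, integral_finsetSum_measure fun a _ =>
    (integrable_of_continuous _ hf).smul_measure ENNReal.ofReal_ne_top]
  simp only [integral_smul_measure, ENNReal.toReal_ofReal (hw0 _), smul_eq_mul]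
  rw [blockMean, sumOver, Finset.sum_div]
  refine Finset.sum_congr rfl fun a _ => ?_
  rw [integral_dirac' _ _ hf.stronglyMeasurable, hw]
  ring

theorem isClosed_abs_sub_integral_le {X : Type*} [TopologicalSpace X] [CompactSpace X]
    [MeasurableSpace X] [OpensMeasurableSpace X] {f : X → ℝ} (hf : Continuous f) (c ε : ℝ) :
    IsClosed {κ : ProbabilityMeasure X | |c - ∫ y, f y ∂(κ : Measure X)| ≤ ε} :=
  isClosed_le (continuous_const.sub
    (ProbabilityMeasure.continuous_integral_continuousMap (⟨f, hf⟩ : C(X, ℝ)))).abs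
    continuous_const

/-- `κ z` is the limit of the block means over the fibre of `z`, uniformly in `z` and in the
boundary condition. -/
def IsFibreLaw (φ : ℕ → (∀ i, A i) → ℝ) (s : ∀ i, Setoid (A i))
    (κ : (∀ i, A i) → ProbabilityMeasure (∀ i, A i)) : Prop :=
  ∀ f : (∀ i, A i) → ℝ, Continuous f → ∀ ε > 0, ∃ N₀, ∀ N ≥ N₀, ∀ z x,
    |blockMean (fibreInd s z) φ N f x - ∫ y, f y ∂(κ z : Measure (∀ i, A i))| ≤ ε

/-- A cluster point of the block means exists by compactness; the small oscillation makes it the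
uniform limit. -/
theorem exists_isFibreLaw {r : ℕ → ℝ} (hr : BerbeeBound φ r) (hφ : IsOnePointPotential φ)
    (s : ∀ i, Setoid (A i)) : ∃ κ, IsFibreLaw φ s κ := by
  have hex : ∀ f : (∀ i, A i) → ℝ, ∀ ε : ℝ, ∃ N, Continuous f → 0 < ε → ∀ z x x',
      blockMean (fibreInd s z) φ N f x - blockMean (fibreInd s z) φ N f x' ≤ ε := by
    intro f ε
    by_cases h : Continuous f ∧ 0 < ε
    · obtain ⟨N, hN⟩ := exists_fibreMean_sub_le hr hφ s h.1 h.2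
      exact ⟨N, fun _ _ => hN⟩
    · exact ⟨0, fun h1 h2 => absurd ⟨h1, h2⟩ h⟩
  choose N₀ hN₀ using hex
  have hν : ∀ z : ∀ i, A i, ∃ ν : ℕ → ProbabilityMeasure (∀ i, A i), ∀ N,
      ∀ f : (∀ i, A i) → ℝ, Continuous f →
        ∫ y, f y ∂(ν N : Measure (∀ i, A i)) = blockMean (fibreInd s z) φ N f z := by
    intro z
    choose ν hν using fun N =>
      exists_integral_eq_blockMean (fibreInd_nonneg s z) (exists_fibreInd_pos s z) φ N z
    exact ⟨ν, hν⟩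
  have hκ : ∀ z : ∀ i, A i, ∃ κ : ProbabilityMeasure (∀ i, A i), ∀ f : (∀ i, A i) → ℝ,
      Continuous f → ∀ ε > 0, ∀ x, ∀ N ≥ N₀ f ε,
        |blockMean (fibreInd s z) φ N f x - ∫ y, f y ∂(κ : Measure (∀ i, A i))| ≤ ε := by
    intro z
    obtain ⟨ν, hν⟩ := hν z
    obtain ⟨κ, hκ⟩ := exists_clusterPt_of_compactSpace (map ν atTop)
    refine ⟨κ, fun f hf ε hε x N hN => ?_⟩
    refine (isClosed_abs_sub_integral_le hf (blockMean (fibreInd s z) φ N f x)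
      ε).mem_of_mapClusterPt hκ ?_
    filter_upwards [eventually_ge_atTop N] with N' hN'
    have hosc := hN₀ f ε hf hε z
    have hχ := fibreInd_nonneg s z
    have hχ' := exists_fibreInd_pos s z
    have hosc' : ∀ x x', blockMean (fibreInd s z) φ N f x - blockMean (fibreInd s z) φ N f x'
        ≤ ε := fun x x' => sub_blockMean_le_of_le hχ hχ' hφ.dependsOn hN
      (fun x' => blockMean_sub_le_of_le hχ hχ' hφ.dependsOn hN hosc x x') x'
    rw [hν N' f hf, abs_sub_le_iff]
    exact ⟨sub_blockMean_le_of_le hχ hχ' hφ.dependsOn hN' (hosc' x) z,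
      blockMean_sub_le_of_le hχ hχ' hφ.dependsOn hN' hosc' z x⟩
  choose κ hκ using hκ
  exact ⟨κ, fun f hf ε hε => ⟨N₀ f ε, fun N hN z x => hκ z f hf ε hε x N hN⟩⟩

variable {s : ∀ i, Setoid (A i)} {κ : (∀ i, A i) → ProbabilityMeasure (∀ i, A i)}

theorem IsFibreLaw.tendsto {A : ℕ → Type*} [∀ i, Fintype (A i)] [∀ i, TopologicalSpace (A i)]
    [∀ i, MeasurableSpace (A i)] {φ : ℕ → (∀ i, A i) → ℝ} {s : ∀ i, Setoid (A i)}
    {κ : (∀ i, A i) → ProbabilityMeasure (∀ i, A i)} (hκ : IsFibreLaw φ s κ)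
    {f : (∀ i, A i) → ℝ} (hf : Continuous f) (z x : ∀ i, A i) :
    Tendsto (fun N => blockMean (fibreInd s z) φ N f x) atTop
      (𝓝 (∫ y, f y ∂(κ z : Measure (∀ i, A i)))) := by
  refine Metric.tendsto_atTop.2 fun ε hε => ?_
  obtain ⟨N₀, h⟩ := hκ f hf (ε / 2) (half_pos hε)
  exact ⟨N₀, fun N hN => (h N hN z x).trans_lt (half_lt_self hε)⟩

theorem continuous_diag {X : Type*} [TopologicalSpace X] {F : X → X → ℝ}
    (hF : Continuous fun p : X × X => F p.1 p.2) : Continuous fun z => F z z :=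
  hF.comp (continuous_id.prodMk continuous_id)

theorem IsFibreLaw.continuous (hκ : IsFibreLaw φ s κ) (hφ : ∀ n, Continuous (φ n)) :
    Continuous κ := by
  rw [ProbabilityMeasure.continuous_iff_forall_continuousMap_continuous_integral]
  intro f
  have h : TendstoUniformly (fun N z => blockMean (fibreInd s z) φ N f z)
      (fun z => ∫ y, f y ∂(κ z : Measure (∀ i, A i))) atTop := by
    rw [Metric.tendstoUniformly_iff]
    intro ε hε
    obtain ⟨N₀, h⟩ := hκ f f.continuous (ε / 2) (half_pos hε)
    filter_upwards [eventually_ge_atTop N₀] with N hN z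
    rw [dist_comm]
    exact (h N hN z z).trans_lt (half_lt_self hε)
  have hc : ∀ N, Continuous fun z => blockMean (fibreInd s z) φ N f z := fun N =>
    continuous_diag (continuous_blockMean_fibreInd s hφ N f.continuous)
  exact h.continuous (Eventually.frequently <| .of_forall hc)

theorem probabilityMeasure_ext {X : Type*} [TopologicalSpace X] [MeasurableSpace X]
    [HasOuterApproxClosed X] [BorelSpace X] {ν ν' : ProbabilityMeasure X}
    (h : ∀ f : X → ℝ, Continuous f → ∫ y, f y ∂(ν : Measure X) = ∫ y, f y ∂(ν' : Measure X)) :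
    ν = ν' := by
  have : (ν : Measure X) = (ν' : Measure X) :=
    ext_of_forall_integral_eq_of_IsFiniteMeasure fun f => h f f.continuous
  exact Subtype.ext this

theorem IsFibreLaw.congr (hκ : IsFibreLaw φ s κ) {z z' : ∀ i, A i} (h : ∀ i, s i (z i) (z' i)) :
    κ z = κ z' := by
  refine probabilityMeasure_ext fun f hf => tendsto_nhds_unique (hκ.tendsto hf z z) ?_
  rw [fibreInd_congr h]
  exact hκ.tendsto hf z' z

theorem blockMean_fibreInd_congr {A : ℕ → Type*} [∀ i, Fintype (A i)]
    {φ : ℕ → (∀ i, A i) → ℝ} {s : ∀ i, Setoid (A i)} (z : ∀ i, A i) (N : ℕ) {f g : (∀ i, A i) → ℝ}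
    (h : ∀ x, (∀ i, s i (x i) (z i)) → f x = g x) :
    blockMean (fibreInd s z) φ N f z = blockMean (fibreInd s z) φ N g z := by
  unfold blockMean
  congr 1
  refine Finset.sum_congr rfl fun a _ => ?_
  beta_reduce
  by_cases ha : ∀ i, s i (Function.updateFinset z (Finset.range N) a i) (z i)
  · rw [h _ ha]
  · push Not at ha
    obtain ⟨i, hi⟩ := ha
    have hiN : i ∈ Finset.range N := by
      by_contra hiN
      exact hi (by simp only [Function.updateFinset, hiN, dif_neg, not_false_eq_true]
                   exact (s i).refl _)
    have hw : weight (fibreInd s z) φ (Finset.range N)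
        (Function.updateFinset z (Finset.range N) a) = 0 := by
      refine Finset.prod_eq_zero hiN ?_
      rw [fibreInd, if_neg hi, zero_mul]
    rw [hw, zero_mul, zero_mul]

/-- The law `κ z` is carried by the fibre of `z`. -/
theorem IsFibreLaw.integral_congr {A : ℕ → Type*} [∀ i, Fintype (A i)] [∀ i, TopologicalSpace (A i)]
    [∀ i, MeasurableSpace (A i)] {φ : ℕ → (∀ i, A i) → ℝ} {s : ∀ i, Setoid (A i)}
    {κ : (∀ i, A i) → ProbabilityMeasure (∀ i, A i)} (hκ : IsFibreLaw φ s κ)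
    (z : ∀ i, A i) {f g : (∀ i, A i) → ℝ} (hf : Continuous f) (hg : Continuous g)
    (h : ∀ x, (∀ i, s i (x i) (z i)) → f x = g x) :
    ∫ y, f y ∂(κ z : Measure (∀ i, A i)) = ∫ y, g y ∂(κ z : Measure (∀ i, A i)) := by
  refine tendsto_nhds_unique (hκ.tendsto hf z z) ?_
  simp only [blockMean_fibreInd_congr (φ := φ) z _ h]
  exact hκ.tendsto hg z z

end FibreLaw

/-! ### Gibbs measures and block means -/

section Gibbs

variable {A : ℕ → Type*} [∀ i, Fintype (A i)]

/-- The mean of `f` under the specification on `Λ`. -/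
noncomputable def gibbsMean (φ : ℕ → (∀ i, A i) → ℝ) (Λ : Finset ℕ) (f : (∀ i, A i) → ℝ)
    (x : ∀ i, A i) : ℝ :=
  sumOver Λ (fun x => Real.exp (blockPotential φ Λ x) * f x) x
    / sumOver Λ (fun x => Real.exp (blockPotential φ Λ x)) x

theorem updateFinset_updateFinset_self {A : ℕ → Type*} (x : ∀ i, A i) (Λ : Finset ℕ)
    (a b : ∀ i : Λ, A i) :
    Function.updateFinset (Function.updateFinset x Λ a) Λ b = Function.updateFinset x Λ b :=
  Function.updateFinset_updateFinset_of_subset subset_rfl x a b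

theorem sum_mul_specification (φ : ℕ → (∀ i, A i) → ℝ) (Λ : Finset ℕ) (f : (∀ i, A i) → ℝ)
    (x : ∀ i, A i) :
    ∑ a : (∀ i : Λ, A i), f (Function.updateFinset x Λ a) *
        specification φ Λ (Function.updateFinset x Λ a) = gibbsMean φ Λ f x := by
  have h : ∀ a : (∀ i : Λ, A i), partitionFunction φ Λ (Function.updateFinset x Λ a)
      = sumOver Λ (fun x => Real.exp (blockPotential φ Λ x)) x := fun a => by
    unfold partitionFunction sumOver
    simp only [updateFinset_updateFinset_self]
  simp only [gibbsMean, specification, h]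
  set Z := sumOver Λ (fun x => Real.exp (blockPotential φ Λ x)) x
  rw [sumOver, Finset.sum_div]
  refine Finset.sum_congr rfl fun a _ => ?_
  ring

theorem gibbsMean_range (φ : ℕ → (∀ i, A i) → ℝ) (N : ℕ) :
    gibbsMean φ (Finset.range N) = blockMean (fun _ _ => 1) φ N := by
  have hsup : (Finset.range N).sup (fun i => i + 1) = N := by
    refine le_antisymm (Finset.sup_le fun i hi => Finset.mem_range.1 hi) ?_
    rcases N with _ | n
    · exact Nat.zero_le _
    · exact Finset.le_sup (f := fun i => i + 1) (Finset.self_mem_range_succ n)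
  have hw : ∀ x, Real.exp (blockPotential φ (Finset.range N) x)
      = weight (fun _ _ => 1) φ (Finset.range N) x := fun x => by
    rw [blockPotential, hsup, Real.exp_sum, weight]
    simp only [one_mul]
  funext f x
  simp only [gibbsMean, hw]
  rfl

/-- Resampling twice within classes of an equivalence relation: the weighted sum of the class means
of `f` is the weighted sum of `f`. -/
theorem sum_mul_classMean {α : Type*} [Fintype α] {I : α → α → ℝ} (hsymm : ∀ a b, I a b = I b a)
    (hI : ∀ a b, I a b ≠ 0 → I a = I b) (W f : α → ℝ) (hZ : ∀ a, ∑ c, I a c * W c ≠ 0) :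
    ∑ a, W a * ((∑ b, I a b * W b * f b) / ∑ c, I a c * W c) = ∑ b, W b * f b := by
  simp only [Finset.sum_div, Finset.mul_sum]
  rw [Finset.sum_comm]
  refine Finset.sum_congr rfl fun b _ => ?_
  have h : ∀ a, W a * (I a b * W b * f b / ∑ c, I a c * W c)
      = (I b a * W a) * (W b * f b / ∑ c, I b c * W c) := by
    intro a
    by_cases hab : I a b = 0
    · rw [← hsymm a b, hab]
      ring
    · rw [hI a b hab, hsymm b a, hI a b hab]
      ring
  simp only [h]
  rw [← Finset.sum_mul]
  field_simp [hZ b]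

theorem weight_eq_mul {A : ℕ → Type*} (χ : ∀ i, A i → ℝ) (φ : ℕ → (∀ i, A i) → ℝ)
    (S : Finset ℕ) (x : ∀ i, A i) :
    weight χ φ S x = (∏ i ∈ S, χ i (x i)) * weight (fun _ _ => 1) φ S x := by
  simp only [weight, one_mul, Finset.prod_mul_distrib]

/-- Resampling a block within its fibre leaves the block mean invariant. -/
theorem blockMean_fibreMean (s : ∀ i, Setoid (A i)) (φ : ℕ → (∀ i, A i) → ℝ) (N : ℕ)
    (f : (∀ i, A i) → ℝ) (x : ∀ i, A i) :
    blockMean (fun _ _ => 1) φ N (fun z => blockMean (fibreInd s z) φ N f z) x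
      = blockMean (fun _ _ => 1) φ N f x := by
  set u : (∀ i : Finset.range N, A i) → ∀ i, A i := Function.updateFinset x (Finset.range N)
    with hu
  set I : (∀ i : Finset.range N, A i) → (∀ i : Finset.range N, A i) → ℝ := fun a b =>
    ∏ i ∈ Finset.range N, fibreInd s (u a) i (u b i) with hI
  -- `I a b` indicates that the configurations `a` and `b` on the block lie in the same fibre.
  have hne : ∀ a b, I a b ≠ 0 ↔ ∀ i ∈ Finset.range N, s i (u b i) (u a i) := by
    intro a b
    rw [hI, Finset.prod_ne_zero_iff]
    refine forall₂_congr fun i _ => ?_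
    simp [fibreInd]
  have hcongr : ∀ a b, I a b ≠ 0 → I a = I b := by
    intro a b hab
    rw [hne] at hab
    funext c
    refine Finset.prod_congr rfl fun i hi => ?_
    have : s i (u c i) (u a i) ↔ s i (u c i) (u b i) :=
      ⟨fun h => (s i).trans h ((s i).symm (hab i hi)), fun h => (s i).trans h (hab i hi)⟩
    classical
    unfold fibreInd
    split_ifs <;> first | rfl | tauto
  have hsymm : ∀ a b, I a b = I b a := by
    intro a b
    refine Finset.prod_congr rfl fun i _ => ?_
    have : s i (u b i) (u a i) ↔ s i (u a i) (u b i) := ⟨(s i).symm, (s i).symm⟩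
    classical
    unfold fibreInd
    split_ifs <;> first | rfl | tauto
  have key : ∀ (g : (∀ i, A i) → ℝ) a,
      sumOver (Finset.range N) (fun y => weight (fibreInd s (u a)) φ (Finset.range N) y * g y) (u a)
        = ∑ b, I a b * weight (fun _ _ => 1) φ (Finset.range N) (u b) * g (u b) := by
    intro g a
    refine Finset.sum_congr rfl fun b _ => ?_
    beta_reduce
    rw [hu, updateFinset_updateFinset_self, weight_eq_mul]
  have key1 : ∀ a, sumOver (Finset.range N) (weight (fibreInd s (u a)) φ (Finset.range N)) (u a)
        = ∑ b, I a b * weight (fun _ _ => 1) φ (Finset.range N) (u b) := by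
    intro a
    simpa using key (fun _ => 1) a
  have hZ : ∀ a, ∑ c, I a c * weight (fun _ _ => 1) φ (Finset.range N) (u c) ≠ 0 := fun a => by
    rw [← key1]
    exact (sumOver_weight_pos (fibreInd_nonneg s _) (exists_fibreInd_pos s _) φ N _).ne'
  unfold blockMean
  congr 1
  have := sum_mul_classMean hsymm hcongr
    (fun a => weight (fun _ _ => 1) φ (Finset.range N) (u a)) (fun a => f (u a)) hZ
  rw [sumOver, sumOver, ← this]
  refine Finset.sum_congr rfl fun a _ => ?_
  beta_reduce
  rw [← hu, key f a, key1 a]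

variable [∀ i, TopologicalSpace (A i)] [∀ i, MeasurableSpace (A i)]
  {φ : ℕ → (∀ i, A i) → ℝ} {μ : Measure (∀ i, A i)}

theorem IsGibbs.integral_eq_gibbsMean (hμ : IsGibbs φ μ) (Λ : Finset ℕ) {f : (∀ i, A i) → ℝ}
    (hf : Continuous f) : ∫ x, f x ∂μ = ∫ x, gibbsMean φ Λ f x ∂μ := by
  simp only [← sum_mul_specification]
  exact hμ Λ ⟨f, hf⟩

theorem IsGibbs.integral_eq_blockMean (hμ : IsGibbs φ μ) (N : ℕ) {f : (∀ i, A i) → ℝ}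
    (hf : Continuous f) : ∫ x, f x ∂μ = ∫ x, blockMean (fun _ _ => 1) φ N f x ∂μ := by
  rw [hμ.integral_eq_gibbsMean (Finset.range N) hf, gibbsMean_range]

variable [∀ i, DiscreteTopology (A i)]

theorem IsGibbs.integral_eq_fibreMean (hμ : IsGibbs φ μ) (hφ : ∀ n, Continuous (φ n))
    (s : ∀ i, Setoid (A i)) (N : ℕ) {f : (∀ i, A i) → ℝ} (hf : Continuous f) :
    ∫ x, f x ∂μ = ∫ x, blockMean (fibreInd s x) φ N f x ∂μ := by
  rw [hμ.integral_eq_blockMean N hf, hμ.integral_eq_blockMean N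
    (continuous_diag (F := fun z x => blockMean (fibreInd s z) φ N f x)
      (continuous_blockMean_fibreInd s hφ N hf))]
  simp only [blockMean_fibreMean]

/-- A Gibbs measure is the mixture of the laws on the fibres. -/
theorem IsGibbs.integral_eq_integral_fibreLaw [∀ i, BorelSpace (A i)] [IsProbabilityMeasure μ]
    (hμ : IsGibbs φ μ) (hφ : ∀ n, Continuous (φ n)) {s : ∀ i, Setoid (A i)}
    {κ : (∀ i, A i) → ProbabilityMeasure (∀ i, A i)} (hκ : IsFibreLaw φ s κ)
    {f : (∀ i, A i) → ℝ} (hf : Continuous f) :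
    ∫ x, f x ∂μ = ∫ x, ∫ y, f y ∂(κ x : Measure (∀ i, A i)) ∂μ := by
  have hc1 : Continuous fun x => ∫ y, f y ∂(κ x : Measure (∀ i, A i)) :=
    (ProbabilityMeasure.continuous_integral_continuousMap (⟨f, hf⟩ : C((∀ i, A i), ℝ))).comp
      (hκ.continuous hφ)
  refine eq_of_abs_sub_le_all fun ε hε => ?_
  obtain ⟨N, hN⟩ := hκ f hf ε hε
  have hc2 : Continuous fun x => blockMean (fibreInd s x) φ N f x :=
    continuous_diag (continuous_blockMean_fibreInd s hφ N hf)
  rw [hμ.integral_eq_fibreMean hφ s N hf, ← integral_sub (integrable_of_continuous _ hc2)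
    (integrable_of_continuous _ hc1)]
  have := norm_integral_le_of_norm_le_const (μ := μ) (C := ε)
    (f := fun x => blockMean (fibreInd s x) φ N f x - ∫ y, f y ∂(κ x : Measure (∀ i, A i)))
    (.of_forall fun x => hN N le_rfl x x)
  simpa using this

/-- If a Gibbs measure vanishes on a non-empty open set, it annihilates a continuous function with
values in `[0, 1]` all of whose means over a large block are positive. -/
theorem IsGibbs.isOpenPosMeasure [∀ i, BorelSpace (A i)] [IsProbabilityMeasure μ]
    (hμ : IsGibbs φ μ) (hφ : ∀ n, Continuous (φ n)) : μ.IsOpenPosMeasure := by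
  refine ⟨fun U hU ⟨x₀, hx₀⟩ h0 => ?_⟩
  obtain ⟨f, hf0, hf1, hf01⟩ := exists_continuous_zero_one_of_isClosed hU.isClosed_compl
    (isClosed_singleton (x := x₀)) (Set.disjoint_singleton_right.2 fun h => h hx₀)
  obtain ⟨N, hN⟩ := exists_forall_abs_sub_le f.continuous (show (0 : ℝ) < 1 / 2 by norm_num)
  have hpos : ∀ x, 0 < blockMean (fun _ _ => 1) φ N f x := by
    intro x
    refine div_pos (sumOver_pos (y := fun i => if i < N then x₀ i else x i)
      (fun y => mul_nonneg (weight_nonneg (fun _ _ => zero_le_one) φ _ y) (hf01 y).1)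
      (fun i hi => by simp [Finset.mem_range.not.1 hi]) (mul_pos ?_ ?_))
      (sumOver_weight_pos (fun _ _ => zero_le_one) (fun i => ⟨x i, one_pos⟩) φ N x)
    · exact Finset.prod_pos fun i _ => mul_pos one_pos (Real.exp_pos _)
    · have h1 := hN x₀ (fun i => if i < N then x₀ i else x i) fun i hi => by simp [hi]
      rw [hf1 rfl] at h1
      have := (abs_le.1 h1).2
      simp only [Pi.one_apply] at this
      linarith
  have hint : ∫ x, f x ∂μ = 0 := by
    refine integral_eq_zero_of_ae ?_
    have : ∀ᵐ x ∂μ, x ∉ U := measure_eq_zero_iff_ae_notMem.1 h0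
    filter_upwards [this] with x hx
    exact hf0 hx
  rw [hμ.integral_eq_blockMean N f.continuous] at hint
  have hcont : Continuous (blockMean (fun _ _ => 1) φ N f) := by
    have hw : Continuous (weight (fun (i : ℕ) (_ : A i) => 1) φ (Finset.range N)) :=
      continuous_finsetProd _ fun i _ =>
        continuous_const.mul (Real.continuous_exp.comp (hφ i))
    exact (continuous_sumOver _ (hw.mul f.continuous)).div (continuous_sumOver _ hw) fun x =>
      (sumOver_weight_pos (fun _ _ => zero_le_one) (fun i => ⟨x i, one_pos⟩) φ N x).ne'
  rw [integral_eq_zero_iff_of_nonneg (fun x => (hpos x).le)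
    (integrable_of_continuous μ hcont)] at hint
  obtain ⟨x, hx⟩ := hint.exists
  exact (hpos x).ne' hx

end Gibbs

/-! ### Continuous versions of conditional laws -/

section CondLaw

theorem measurable_of_continuous_probabilityMeasure {X E : Type*} [TopologicalSpace X]
    [MeasurableSpace X] [BorelSpace X] [HasOuterApproxClosed X] [TopologicalSpace E]
    [MeasurableSpace E] [OpensMeasurableSpace E] {κ : E → ProbabilityMeasure X}
    (hκ : Continuous κ) : Measurable fun e => (κ e : Measure X) := by
  refine Measurable.measure_of_isPiSystem_of_isProbabilityMeasure
    (S := {F : Set X | IsClosed F}) ?_ isPiSystem_isClosed fun F hF => ?_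
  · rw [BorelSpace.measurable_eq (α := X), borel_eq_generateFrom_isClosed]
  · refine ENNReal.measurable_of_tendsto
      (f := fun n e => ∫⁻ x, hF.apprSeq n x ∂(κ e : Measure X)) (fun n => ?_)
      (tendsto_pi_nhds.2 fun e => HasOuterApproxClosed.tendsto_lintegral_apprSeq hF _)
    exact (ProbabilityMeasure.continuous_iff_forall_continuous_lintegral.1 hκ _).measurable

variable {A : ℕ → Type*} [∀ i, Fintype (A i)] [∀ i, Nonempty (A i)] [∀ i, TopologicalSpace (A i)]
  [∀ i, DiscreteTopology (A i)] [∀ i, MeasurableSpace (A i)] [∀ i, BorelSpace (A i)]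
  {φ : ℕ → (∀ i, A i) → ℝ} {μ : Measure (∀ i, A i)} [IsProbabilityMeasure μ]
  {E : Type*} [TopologicalSpace E] [MeasurableSpace E] [BorelSpace E]

/-- Two continuous versions of the conditional law coincide, since a Gibbs measure charges all
open sets. -/
theorem isContinuousCondLaw_unique (hμ : IsGibbs φ μ) (hφ : ∀ n, Continuous (φ n))
    {p : (∀ i, A i) → E} (hp : Continuous p) (hsurj : Function.Surjective p)
    {κ κ' : E → ProbabilityMeasure (∀ i, A i)} (hκ : IsContinuousCondLaw μ p κ)
    (hκ' : IsContinuousCondLaw μ p κ') : κ = κ' := by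
  have := hμ.isOpenPosMeasure hφ
  have : (μ.map p).IsOpenPosMeasure := hp.isOpenPosMeasure_map hsurj
  refine Continuous.ae_eq_iff_eq (μ.map p) hκ.1 hκ'.1 |>.1 ?_
  filter_upwards [hκ.2, hκ'.2] with e h1 h2
  exact Subtype.ext (h1.trans h2.symm)

/-- Integrals against `μ` are computed by conditioning on `p`. -/
theorem IsContinuousCondLaw.integral_mul {p : (∀ i, A i) → E} (hp : Continuous p)
    {κ : E → ProbabilityMeasure (∀ i, A i)} (hκ : IsContinuousCondLaw μ p κ)
    {f : (∀ i, A i) → ℝ} (hf : Continuous f) {g : E → ℝ} (hg : Continuous g) :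
    ∫ x, g (p x) * f x ∂μ = ∫ x, g (p x) * ∫ y, f y ∂(κ (p x) : Measure (∀ i, A i)) ∂μ := by
  have hgraph : Continuous fun x => (p x, id x) := hp.prodMk continuous_id
  have hF : Continuous fun q : E × (∀ i, A i) => g q.1 * f q.2 :=
    (hg.comp continuous_fst).mul (hf.comp continuous_snd)
  have hcomp := compProd_map_condDistrib (mβ := ‹MeasurableSpace E›) (X := p)
    (Y := (id : (∀ i, A i) → ∀ i, A i)) (μ := μ) aemeasurable_id
  have h1 : ∫ x, g (p x) * f x ∂μ
      = ∫ q, g q.1 * f q.2 ∂(μ.map fun x => (p x, id x)) :=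
    (integral_map hgraph.aemeasurable hF.aestronglyMeasurable).symm
  have hint : Integrable (fun q : E × (∀ i, A i) => g q.1 * f q.2)
      (μ.map fun x => (p x, id x)) :=
    (integrable_map_measure hF.aestronglyMeasurable hgraph.aemeasurable).2
      (integrable_of_continuous μ (hF.comp hgraph))
  rw [h1, ← hcomp, Measure.integral_compProd (by rwa [hcomp])]
  have h2 : ∀ᵐ e ∂(μ.map p), ∫ y, g e * f y ∂(condDistrib id p μ e)
      = g e * ∫ y, f y ∂(κ e : Measure (∀ i, A i)) := by
    filter_upwards [hκ.2] with e he
    rw [he, integral_const_mul]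
  rw [integral_congr_ae h2, integral_map hp.aemeasurable]
  have hc : Continuous fun e => ∫ y, f y ∂(κ e : Measure (∀ i, A i)) :=
    (ProbabilityMeasure.continuous_integral_continuousMap (⟨f, hf⟩ : C((∀ i, A i), ℝ))).comp hκ.1
  exact (hg.mul hc).aestronglyMeasurable

variable [TopologicalSpace.MetrizableSpace E]

/-- If the classes of `s` are the fibres of `p`, the laws on the fibres form a continuous version of
the conditional law given `p`. -/
theorem IsFibreLaw.isContinuousCondLaw (hμ : IsGibbs φ μ) (hφ : ∀ n, Continuous (φ n))
    {s : ∀ i, Setoid (A i)} {κ : (∀ i, A i) → ProbabilityMeasure (∀ i, A i)}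
    (hκ : IsFibreLaw φ s κ) {p : (∀ i, A i) → E} (hp : Continuous p) {σ : E → ∀ i, A i}
    (hσ : Continuous σ) (hpσ : ∀ e, p (σ e) = e)
    (hs : ∀ x x', p x = p x' ↔ ∀ i, s i (x i) (x' i)) :
    IsContinuousCondLaw μ p (κ ∘ σ) := by
  have hc : Continuous (κ ∘ σ) := (hκ.continuous hφ).comp hσ
  refine ⟨hc, ?_⟩
  set K : Kernel E (∀ i, A i) := ⟨fun e => ((κ ∘ σ) e : Measure (∀ i, A i)),
    measurable_of_continuous_probabilityMeasure hc⟩ with hK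
  have hKprob : IsMarkovKernel K := ⟨fun e => inferInstanceAs
    (IsProbabilityMeasure ((κ ∘ σ) e : Measure (∀ i, A i)))⟩
  have hκσ : ∀ x, κ (σ (p x)) = κ x := fun x => hκ.congr ((hs _ _).1 (hpσ (p x)))
  have hcomp : μ.map (fun x => (p x, id x)) = μ.map p ⊗ₘ K := by
    have : IsProbabilityMeasure (μ.map p) := Measure.isProbabilityMeasure_map hp.aemeasurable
    have hgraph : Continuous fun x => (p x, id x) := hp.prodMk continuous_id
    have : IsProbabilityMeasure (μ.map fun x => (p x, id x)) :=
      Measure.isProbabilityMeasure_map hgraph.aemeasurable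
    refine ext_of_forall_integral_eq_of_IsFiniteMeasure fun h => ?_
    rw [integral_map hgraph.aemeasurable h.continuous.aestronglyMeasurable,
      Measure.integral_compProd (h.integrable _),
      integral_map hp.aemeasurable
        (h.continuous.stronglyMeasurable.integral_kernel_prod_right').aestronglyMeasurable,
      hμ.integral_eq_integral_fibreLaw (f := fun x => h (p x, id x)) hφ hκ
        (h.continuous.comp hgraph)]
    refine integral_congr_ae (.of_forall fun x => ?_)
    change ∫ y, h (p y, y) ∂(κ x : Measure (∀ i, A i))
      = ∫ y, h (p x, y) ∂(κ (σ (p x)) : Measure (∀ i, A i))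
    rw [hκσ]
    refine hκ.integral_congr x (h.continuous.comp hgraph)
      (h.continuous.comp (continuous_const.prodMk continuous_id)) fun y hy => ?_
    rw [(hs y x).2 hy]
  filter_upwards [condDistrib_ae_eq_of_measure_eq_compProd p aemeasurable_id hcomp] with e he
  rw [he]
  rfl

/-- A map whose fibres are the products of the classes of `s`, and which has a continuous section,
admits a unique continuous version of the conditional law. -/
theorem existsUnique_isContinuousCondLaw {r : ℕ → ℝ} (hr : BerbeeBound φ r)
    (hφ : IsOnePointPotential φ) (hμ : IsGibbs φ μ)
    {s : ∀ i, Setoid (A i)} {p : (∀ i, A i) → E} (hp : Continuous p) {σ : E → ∀ i, A i}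
    (hσ : Continuous σ) (hpσ : ∀ e, p (σ e) = e)
    (hs : ∀ x x', p x = p x' ↔ ∀ i, s i (x i) (x' i)) :
    ∃! κ : E → ProbabilityMeasure (∀ i, A i), IsContinuousCondLaw μ p κ := by
  obtain ⟨κ, hκ⟩ := exists_isFibreLaw hr hφ s
  refine ⟨κ ∘ σ, hκ.isContinuousCondLaw hμ hφ.continuous hp hσ hpσ hs, fun κ' hκ' => ?_⟩
  exact isContinuousCondLaw_unique hμ hφ.continuous hp (fun e => ⟨σ e, hpσ e⟩) hκ'
    (hκ.isContinuousCondLaw hμ hφ.continuous hp hσ hpσ hs)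

end CondLaw

/-! ### Berbee's condition in terms of real numbers -/

section Berbee

variable {A : ℕ → Type*} {φ : ℕ → (∀ i, A i) → ℝ}

theorem uniformVariation_anti (φ : ℕ → (∀ i, A i) → ℝ) : Antitone (uniformVariation φ) := by
  intro k k' hkk'
  refine iSup_mono fun n => iSup_mono fun x => iSup_mono fun y => iSup_le fun h => ?_
  exact le_iSup_of_le (fun i h1 h2 => h i h1 (by omega)) le_rfl

theorem BerbeeCondition.uniformVariation_ne_top (h : BerbeeCondition φ) {k : ℕ} (hk : 1 ≤ k) :
    uniformVariation φ k ≠ ⊤ := by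
  intro hk'
  have h1 : uniformVariation φ 1 = ⊤ := top_le_iff.1 (hk' ▸ uniformVariation_anti φ hk)
  -- If `r 1 = ∞`, all terms of the series vanish.
  have h2 : ∀ n : ℕ, ∑ k ∈ Finset.Icc 1 (n + 1), uniformVariation φ k = ⊤ := fun n =>
    ENNReal.sum_eq_top.2 ⟨1, by simp, h1⟩
  unfold BerbeeCondition at h
  simp only [h2, EReal.coe_ennreal_top, EReal.neg_top, EReal.exp_bot, tsum_zero] at h
  exact ENNReal.zero_ne_top h

/-- Berbee's condition forces every `uniformVariation φ k` with `k ≥ 1` to be finite, so it is a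
statement about a series of real numbers. -/
theorem BerbeeCondition.berbeeBound (h : BerbeeCondition φ) :
    BerbeeBound φ fun k => (uniformVariation φ k).toReal := by
  refine ⟨?_, fun k _ => ENNReal.toReal_nonneg, fun k k' hk hkk' =>
    ENNReal.toReal_mono (h.uniformVariation_ne_top hk) (uniformVariation_anti φ hkk'), ?_⟩
  · intro n k x y hk hxy
    have : ENNReal.ofReal |φ n x - φ n y| ≤ uniformVariation φ k :=
      le_iSup_of_le n <| le_iSup_of_le x <| le_iSup_of_le y <| le_iSup_of_le hxy le_rfl
    exact (ENNReal.ofReal_le_iff_le_toReal (h.uniformVariation_ne_top hk)).1 this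
  · intro hsum
    have hsum' := (summable_nat_add_iff 1).2 hsum
    have hterm : ∀ n : ℕ, EReal.exp
        (-((∑ k ∈ Finset.Icc 1 (n + 1), uniformVariation φ k : ℝ≥0∞) : EReal))
        = ENNReal.ofReal (Real.exp
          (-∑ k ∈ Finset.Icc 1 (n + 1), (uniformVariation φ k).toReal)) := by
      intro n
      have hfin : ∀ k ∈ Finset.Icc 1 (n + 1), uniformVariation φ k ≠ ⊤ := fun k hk =>
        h.uniformVariation_ne_top (Finset.mem_Icc.1 hk).1
      rw [← ENNReal.toReal_sum hfin, ← EReal.exp_coe, EReal.coe_neg,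
        EReal.coe_ennreal_toReal (ENNReal.sum_ne_top.2 hfin)]
    unfold BerbeeCondition at h
    simp only [hterm] at h
    exact hsum'.tsum_ofReal_ne_top h

end Berbee

/-! ### Normalised potentials -/

section Normalised

variable {A : ℕ → Type*} [∀ i, Fintype (A i)] {φ : ℕ → (∀ i, A i) → ℝ}

/-- The mean of `f` when the `n`-th coordinate is resampled with the weights `exp (φ n)`. -/
noncomputable def stepMean (φ : ℕ → (∀ i, A i) → ℝ) (n : ℕ) (f : (∀ i, A i) → ℝ) :
    (∀ i, A i) → ℝ :=
  sumOver {n} fun x => Real.exp (φ n x) * f x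

theorem exp_dependsOn_Ici {A : ℕ → Type*} {φ : ℕ → (∀ i, A i) → ℝ}
    (hφ : ∀ n, DependsOn (φ n) (Set.Ici n)) (n : ℕ) :
    DependsOn (fun x => Real.exp (φ n x)) (Set.Ici n) := fun _ _ h => by
  simp only [hφ n h]

theorem sumOver_range_succ_weight (hφ : ∀ n, DependsOn (φ n) (Set.Ici n)) (N : ℕ)
    (f : (∀ i, A i) → ℝ) :
    sumOver (Finset.range (N + 1))
        (fun x => weight (fun _ _ => 1) φ (Finset.range (N + 1)) x * f x)
      = stepMean φ N (sumOver (Finset.range N)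
        fun x => weight (fun _ _ => 1) φ (Finset.range N) x * f x) := by
  have hdisj : Disjoint {N} (Finset.range N) := by simp
  have hU : {N} ∪ Finset.range N = Finset.range (N + 1) := by
    ext i
    simp only [Finset.mem_union, Finset.mem_singleton, Finset.mem_range]
    omega
  rw [← hU, ← sumOver_union hdisj, hU, stepMean]
  congr 1
  funext x
  rw [← sumOver_mul_left (exp_dependsOn_Ici hφ N) (disjoint_Ici_range N)]
  congr 1
  funext x
  rw [weight, weight, Finset.prod_range_succ, one_mul]
  ring

theorem stepMean_one (hn : IsNormalised φ) (n : ℕ) (x : ∀ i, A i) :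
    stepMean φ n (fun _ => 1) x = 1 := by
  simp only [stepMean, mul_one, sumOver_singleton]
  exact hn n x

theorem sumOver_weight_eq_one (hφ : ∀ n, DependsOn (φ n) (Set.Ici n)) (hn : IsNormalised φ)
    (N : ℕ) (x : ∀ i, A i) :
    sumOver (Finset.range N) (weight (fun _ _ => 1) φ (Finset.range N)) x = 1 := by
  induction N generalizing x with
  | zero => simp [sumOver_empty, weight]
  | succ N ih =>
    have h := congrFun (sumOver_range_succ_weight hφ N fun _ => 1) x
    simp only [mul_one] at h
    have hone : sumOver (Finset.range N) (weight (fun _ _ => 1) φ (Finset.range N))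
        = fun _ => 1 := funext ih
    exact h.trans (by rw [hone, stepMean_one hn])

theorem blockMean_eq_of_normalised (hφ : ∀ n, DependsOn (φ n) (Set.Ici n)) (hn : IsNormalised φ)
    (N : ℕ) (f : (∀ i, A i) → ℝ) :
    blockMean (fun _ _ => 1) φ N f = sumOver (Finset.range N)
        fun x => weight (fun _ _ => 1) φ (Finset.range N) x * f x := by
  funext x
  rw [blockMean, sumOver_weight_eq_one hφ hn, div_one]

/-- For a normalised potential the block mean is an iteration of resamplings of single coordinates,
from the left to the right. -/
theorem blockMean_succ (hφ : ∀ n, DependsOn (φ n) (Set.Ici n)) (hn : IsNormalised φ) (N : ℕ)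
    (f : (∀ i, A i) → ℝ) :
    blockMean (fun _ _ => 1) φ (N + 1) f = stepMean φ N (blockMean (fun _ _ => 1) φ N f) := by
  rw [blockMean_eq_of_normalised hφ hn, blockMean_eq_of_normalised hφ hn,
    sumOver_range_succ_weight hφ]

theorem blockMean_of_dependsOn_Ici (hφ : ∀ n, DependsOn (φ n) (Set.Ici n)) (hn : IsNormalised φ)
    {N : ℕ} {f : (∀ i, A i) → ℝ} (hf : DependsOn f (Set.Ici N)) :
    blockMean (fun _ _ => 1) φ N f = f := by
  funext x
  rw [blockMean_eq_of_normalised hφ hn]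
  simp only [mul_comm _ (f _)]
  rw [sumOver_mul_left hf (disjoint_Ici_range N), sumOver_weight_eq_one hφ hn, mul_one]

variable [∀ i, TopologicalSpace (A i)]

theorem continuous_gibbsMean (hφ : ∀ n, Continuous (φ n)) (Λ : Finset ℕ) {f : (∀ i, A i) → ℝ}
    (hf : Continuous f) : Continuous (gibbsMean φ Λ f) := by
  have hw : Continuous fun x => Real.exp (blockPotential φ Λ x) :=
    Real.continuous_exp.comp (continuous_finsetSum _ fun k _ => hφ k)
  exact (continuous_sumOver _ (hw.mul hf)).div (continuous_sumOver _ hw) fun x =>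
    (sumOver_pos (fun y => (Real.exp_pos _).le) (fun _ _ => rfl) (Real.exp_pos _)).ne'

variable [∀ i, MeasurableSpace (A i)] {μ : Measure (∀ i, A i)}

theorem IsGibbs.integral_eq_stepMean (hμ : IsGibbs φ μ) (hφ : ∀ n, DependsOn (φ n) (Set.Ici n))
    (hn : IsNormalised φ) (n : ℕ) {f : (∀ i, A i) → ℝ} (hf : Continuous f)
    (hfn : DependsOn f (Set.Ici n)) : ∫ x, f x ∂μ = ∫ x, stepMean φ n f x ∂μ := by
  rw [hμ.integral_eq_blockMean (n + 1) hf, blockMean_succ hφ hn,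
    blockMean_of_dependsOn_Ici hφ hn hfn]

/-- For a normalised potential the Gibbs property follows from the invariance under resampling a
single coordinate given the later ones. -/
theorem isGibbs_of_stepMean (hφ : IsOnePointPotential φ) (hn : IsNormalised φ)
    (hstep : ∀ (n : ℕ) (f : (∀ i, A i) → ℝ), Continuous f → DependsOn f (Set.Ici n) →
      ∫ x, f x ∂μ = ∫ x, stepMean φ n f x ∂μ) : IsGibbs φ μ := by
  have hblock : ∀ (N : ℕ) (f : (∀ i, A i) → ℝ), Continuous f →
      ∫ x, f x ∂μ = ∫ x, blockMean (fun _ _ => 1) φ N f x ∂μ := by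
    intro N f hf
    induction N with
    | zero =>
      rw [blockMean_of_dependsOn_Ici hφ.dependsOn hn
        ((dependsOn_univ f).mono fun i _ => Nat.zero_le i)]
    | succ N ih =>
      have hc : Continuous (blockMean (fun _ _ => 1) φ N f) := by
        rw [← gibbsMean_range]
        exact continuous_gibbsMean hφ.continuous _ hf
      rw [ih, hstep N _ hc (blockMean_dependsOn _ _ _ _), ← blockMean_succ hφ.dependsOn hn]
  intro Λ f
  simp only [sum_mul_specification φ Λ (fun x => f x)]
  set N := Λ.sup fun i => i + 1 with hN
  have hΛ : Λ ⊆ Finset.range N := fun i hi =>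
    Finset.mem_range.2 (Finset.le_sup (f := fun i => i + 1) hi)
  have hw : ∀ x, Real.exp (blockPotential φ Λ x) = weight (fun _ _ => 1) φ (Finset.range N) x := by
    intro x
    rw [blockPotential, Real.exp_sum, weight]
    simp only [one_mul, hN]
  have hdep : DependsOn (gibbsMean φ Λ f) ((Λ : Set ℕ)ᶜ) := by
    intro x y hxy
    have h : ∀ i ∈ Set.univ \ (Λ : Set ℕ), x i = y i := fun i hi => hxy i hi.2
    unfold gibbsMean
    rw [sumOver_dependsOn (dependsOn_univ _) _ h, sumOver_dependsOn (dependsOn_univ _) _ h]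
  have key : blockMean (fun _ _ => 1) φ N (gibbsMean φ Λ f)
      = blockMean (fun _ _ => 1) φ N f := by
    rw [blockMean_eq_of_normalised hφ.dependsOn hn, blockMean_eq_of_normalised hφ.dependsOn hn]
    refine sumOver_congr_of_subset hΛ (funext fun x => ?_)
    simp only [← hw, mul_comm _ (gibbsMean φ Λ f _)]
    rw [sumOver_mul_left hdep disjoint_compl_left, gibbsMean, div_mul_cancel₀]
    exact (sumOver_pos (fun y => (Real.exp_pos _).le) (fun _ _ => rfl) (Real.exp_pos _)).ne'
  rw [hblock N f f.continuous, hblock N _ (continuous_gibbsMean hφ.continuous Λ f.continuous), key]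

end Normalised

/-! ### The factor densities -/

section Factor

variable {A B : ℕ → Type*} [∀ i, Fintype (A i)] [∀ i, DecidableEq (B i)] {φ : ℕ → (∀ i, A i) → ℝ}
  {π : ∀ i, A i → B i}

/-- The probability that `π n` maps the `n`-th coordinate to `b`, when it is resampled with the
weights `exp (φ n)` given the later coordinates of `x`. -/
noncomputable def liftedDensity (φ : ℕ → (∀ i, A i) → ℝ) (π : ∀ i, A i → B i) (n : ℕ) (b : B n)
    (x : ∀ i, A i) : ℝ :=
  ∑ a : A n with π n a = b, Real.exp (φ n (Function.update x n a))

theorem liftedDensity_pos (hπ : ∀ i, Function.Surjective (π i)) (n : ℕ) (b : B n)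
    (x : ∀ i, A i) : 0 < liftedDensity φ π n b x := by
  obtain ⟨a, ha⟩ := hπ n b
  exact Finset.sum_pos (fun _ _ => Real.exp_pos _) ⟨a, by simp [ha]⟩

theorem sum_liftedDensity [∀ i, Fintype (B i)] (hn : IsNormalised φ) (n : ℕ) (x : ∀ i, A i) :
    ∑ b, liftedDensity φ π n b x = 1 := by
  rw [← hn n x]
  exact Finset.sum_fiberwise _ _ _

theorem tail_update {B : ℕ → Type*} (n : ℕ) (y : ∀ i, B i) (b : B n) :
    tail (n + 1) (Function.update y n b) = tail (n + 1) y := by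
  funext ⟨i, hi⟩
  have : i ≠ n := by
    rintro rfl
    exact Nat.not_succ_le_self _ hi
  simp [tail, Set.domRestrict, this]

theorem symbolicMap_update {A B : ℕ → Type*} (π : ∀ i, A i → B i) (x : ∀ i, A i) (n : ℕ)
    (a : A n) :
    symbolicMap π (Function.update x n a) = Function.update (symbolicMap π x) n (π n a) := by
  funext i
  by_cases h : i = n
  · subst h
    simp [symbolicMap]
  · simp [symbolicMap, h]

/-- Resampling the `n`-th coordinate of `x` for a function of `π x`. -/
theorem stepMean_comp_symbolicMap [∀ i, Fintype (B i)] (n : ℕ) (f : (∀ i, B i) → ℝ)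
    (x : ∀ i, A i) :
    stepMean φ n (fun x => f (symbolicMap π x)) x
      = ∑ b, f (Function.update (symbolicMap π x) n b) * liftedDensity φ π n b x := by
  rw [stepMean, sumOver_singleton, ← Finset.sum_fiberwise (g := π n)]
  refine Finset.sum_congr rfl fun b _ => ?_
  rw [liftedDensity, Finset.mul_sum]
  refine Finset.sum_congr rfl fun a ha => ?_
  rw [symbolicMap_update, (Finset.mem_filter.1 ha).2, mul_comm]

variable [∀ i, TopologicalSpace (A i)]

theorem continuous_liftedDensity (hφ : ∀ n, Continuous (φ n)) (n : ℕ) (b : B n) :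
    Continuous (liftedDensity φ π n b) :=
  continuous_finsetSum _ fun _ _ => Real.continuous_exp.comp
    ((hφ n).comp (continuous_id.update n continuous_const))

variable [∀ i, MeasurableSpace (A i)]
  {κ : ∀ n : ℕ, (∀ i : Set.Ici n, B i) → ProbabilityMeasure (∀ i, A i)}

theorem factorDensity_eq (φ : ℕ → (∀ i, A i) → ℝ) (π : ∀ i, A i → B i)
    (κ : ∀ n : ℕ, (∀ i : Set.Ici n, B i) → ProbabilityMeasure (∀ i, A i)) (n : ℕ)
    (y : ∀ i, B i) :
    factorDensity φ π κ n y
      = ∫ x, liftedDensity φ π n (y n) x ∂(κ (n + 1) (tail (n + 1) y) : Measure (∀ i, A i)) :=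
  rfl

theorem factorDensity_update (n : ℕ) (y : ∀ i, B i) (b : B n) :
    factorDensity φ π κ n (Function.update y n b)
      = ∫ x, liftedDensity φ π n b x ∂(κ (n + 1) (tail (n + 1) y) : Measure (∀ i, A i)) := by
  rw [factorDensity_eq, tail_update, Function.update_self]

variable [∀ i, DiscreteTopology (A i)] [∀ i, BorelSpace (A i)]

theorem factorDensity_pos (hφ : ∀ n, Continuous (φ n)) (hπ : ∀ i, Function.Surjective (π i))
    (n : ℕ) (y : ∀ i, B i) : 0 < factorDensity φ π κ n y := by
  have hpos := fun x => liftedDensity_pos (φ := φ) hπ n (y n) x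
  rw [factorDensity_eq, integral_pos_iff_support_of_nonneg (fun x => (hpos x).le)
    (integrable_of_continuous _ (continuous_liftedDensity hφ n (y n)))]
  have : Function.support (liftedDensity φ π n (y n)) = Set.univ :=
    Set.eq_univ_of_forall fun x => (hpos x).ne'
  rw [this, measure_univ]
  exact one_pos

theorem isNormalised_log_factorDensity [∀ i, Fintype (B i)] (hφ : ∀ n, Continuous (φ n))
    (hn : IsNormalised φ) (hπ : ∀ i, Function.Surjective (π i)) :
    IsNormalised fun n y => Real.log (factorDensity φ π κ n y) := by
  intro n y
  have h : ∀ b, Real.exp (Real.log (factorDensity φ π κ n (Function.update y n b)))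
      = ∫ x, liftedDensity φ π n b x ∂(κ (n + 1) (tail (n + 1) y) : Measure (∀ i, A i)) :=
    fun b => by rw [Real.exp_log (factorDensity_pos hφ hπ n _), factorDensity_update]
  simp only [h]
  rw [← integral_finsetSum _ fun b _ =>
    integrable_of_continuous _ (continuous_liftedDensity hφ n b)]
  simp only [sum_liftedDensity hn, integral_const, probReal_univ, smul_eq_mul, mul_one]

variable [∀ i, TopologicalSpace (B i)]

theorem continuous_tail {B : ℕ → Type*} [∀ i, TopologicalSpace (B i)] (n : ℕ) :
    Continuous (tail n : (∀ i, B i) → ∀ i : Set.Ici n, B i) :=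
  continuous_pi fun i => continuous_apply (i : ℕ)

theorem continuous_symbolicMap {A B : ℕ → Type*} [∀ i, TopologicalSpace (A i)]
    [∀ i, DiscreteTopology (A i)] [∀ i, TopologicalSpace (B i)] (π : ∀ i, A i → B i) :
    Continuous (symbolicMap π) :=
  continuous_pi fun i => continuous_of_discreteTopology.comp (continuous_apply i)

theorem isOnePointPotential_log_factorDensity [∀ i, Fintype (B i)] [∀ i, DiscreteTopology (B i)]
    (hφ : ∀ n, Continuous (φ n)) (hπ : ∀ i, Function.Surjective (π i))
    (hκ : ∀ n, Continuous (κ n)) :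
    IsOnePointPotential fun n y => Real.log (factorDensity φ π κ n y) := by
  refine ⟨fun n => Continuous.log ?_ fun y => (factorDensity_pos hφ hπ n y).ne', fun n => ?_⟩
  · have h : ∀ y, factorDensity φ π κ n y = ∑ b, (if y n = b then 1 else 0) *
        ∫ x, liftedDensity φ π n b x ∂(κ (n + 1) (tail (n + 1) y) : Measure (∀ i, A i)) := by
      intro y
      simp [factorDensity_eq]
    simp only [funext h]
    refine continuous_finsetSum _ fun b _ => Continuous.mul ?_ ?_
    · have : Continuous fun c : B n => if c = b then (1 : ℝ) else 0 :=
        continuous_of_discreteTopology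
      exact this.comp (continuous_apply n)
    · exact (ProbabilityMeasure.continuous_integral_continuousMap
        (⟨_, continuous_liftedDensity hφ n b⟩ : C((∀ i, A i), ℝ))).comp
          ((hκ (n + 1)).comp (continuous_tail (n + 1)))
  · intro y y' h
    have h1 : tail (n + 1) y = tail (n + 1) y' := funext fun ⟨i, hi⟩ =>
      h i ((Nat.le_succ n).trans hi)
    simp only [factorDensity_eq, h1, h n Set.self_mem_Ici]

/-- The image measure is Gibbs for the factor densities, because they are the conditional
probabilities of a coordinate given the later ones. -/
theorem isGibbs_log_factorDensity [∀ i, Nonempty (A i)] [∀ i, Fintype (B i)]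
    [∀ i, DiscreteTopology (B i)] [∀ i, MeasurableSpace (B i)] [∀ i, BorelSpace (B i)]
    (hφ : IsOnePointPotential φ) (hn : IsNormalised φ) (hπ : ∀ i, Function.Surjective (π i))
    {μ : Measure (∀ i, A i)} [IsProbabilityMeasure μ] (hμ : IsGibbs φ μ)
    (hκ : ∀ n, IsContinuousCondLaw μ (fun x => tail n (symbolicMap π x)) (κ n)) :
    IsGibbs (fun n y => Real.log (factorDensity φ π κ n y)) (μ.map (symbolicMap π)) := by
  have hψ := isOnePointPotential_log_factorDensity hφ.continuous hπ fun n => (hκ n).1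
  have hψn := isNormalised_log_factorDensity (κ := κ) hφ.continuous hn hπ
  have hS := continuous_symbolicMap π
  refine isGibbs_of_stepMean hψ hψn fun n f hf hfn => ?_
  have hstepc : Continuous (stepMean (fun n y => Real.log (factorDensity φ π κ n y)) n f) :=
    continuous_sumOver _ ((Real.continuous_exp.comp (hψ.continuous n)).mul hf)
  rw [integral_map hS.aemeasurable hf.aestronglyMeasurable,
    integral_map hS.aemeasurable hstepc.aestronglyMeasurable,
    hμ.integral_eq_stepMean hφ.dependsOn hn n (f := fun x => f (symbolicMap π x)) (hf.comp hS)
      fun x x' h => hfn fun i hi => by simp only [symbolicMap, h i hi]]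
  -- An arbitrary continuous extension of tails to full sequences, so that `g b` makes `f` a
  -- function of the tail once the `n`-th coordinate is fixed.
  set e : (∀ i : Set.Ici (n + 1), B i) → ∀ i, B i := fun t i =>
    if h : n + 1 ≤ i then t ⟨i, h⟩ else π i (Classical.arbitrary (A i)) with he
  have hec : Continuous e := by
    refine continuous_pi fun i => ?_
    by_cases h : n + 1 ≤ i
    · simp only [he, h, dif_pos]
      exact continuous_apply (A := fun i : Set.Ici (n + 1) => B i) ⟨i, h⟩
    · simp only [he, h, dif_neg, not_false_eq_true]
      exact continuous_const
  set g : B n → (∀ i : Set.Ici (n + 1), B i) → ℝ := fun b t => f (Function.update (e t) n b)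
    with hg
  have hgc : ∀ b, Continuous (g b) := fun b => hf.comp (hec.update n continuous_const)
  have hge : ∀ b y, g b (tail (n + 1) y) = f (Function.update y n b) := by
    intro b y
    refine hfn fun i hi => ?_
    by_cases h : i = n
    · subst h
      simp
    · have h' : n + 1 ≤ i := Nat.lt_of_le_of_ne hi (Ne.symm h)
      rw [Function.update_of_ne h, Function.update_of_ne h]
      simp only [he, h', dif_pos]
      rfl
  have hpc : Continuous fun x => tail (n + 1) (symbolicMap π x) := (continuous_tail _).comp hS
  have hLc := continuous_liftedDensity (π := π) hφ.continuous n
  have hIc : ∀ b, Continuous fun t =>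
      ∫ x, liftedDensity φ π n b x ∂(κ (n + 1) t : Measure (∀ i, A i)) := fun b =>
    (ProbabilityMeasure.continuous_integral_continuousMap
      (⟨_, hLc b⟩ : C((∀ i, A i), ℝ))).comp (hκ (n + 1)).1
  have h1 : ∀ x, stepMean φ n (fun x => f (symbolicMap π x)) x
      = ∑ b, g b (tail (n + 1) (symbolicMap π x)) * liftedDensity φ π n b x := fun x => by
    simp only [stepMean_comp_symbolicMap, hge]
  have h2 : ∀ x, stepMean (fun n y => Real.log (factorDensity φ π κ n y)) n f (symbolicMap π x)
      = ∑ b, g b (tail (n + 1) (symbolicMap π x)) *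
        ∫ x', liftedDensity φ π n b x'
          ∂(κ (n + 1) (tail (n + 1) (symbolicMap π x)) : Measure (∀ i, A i)) := fun x => by
    rw [stepMean, sumOver_singleton]
    refine Finset.sum_congr rfl fun b _ => ?_
    rw [Real.exp_log (factorDensity_pos hφ.continuous hπ n _), factorDensity_update, hge, mul_comm]
  simp only [h1, h2]
  have hi1 : ∀ b, Integrable (fun x => g b (tail (n + 1) (symbolicMap π x)) *
      liftedDensity φ π n b x) μ := fun b =>
    integrable_of_continuous μ (((hgc b).comp hpc).mul (hLc b))
  have hi2 : ∀ b, Integrable (fun x => g b (tail (n + 1) (symbolicMap π x)) *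
      ∫ x', liftedDensity φ π n b x'
        ∂(κ (n + 1) (tail (n + 1) (symbolicMap π x)) : Measure (∀ i, A i))) μ := fun b =>
    integrable_of_continuous μ (((hgc b).comp hpc).mul ((hIc b).comp hpc))
  rw [integral_finsetSum _ fun b _ => hi1 b, integral_finsetSum _ fun b _ => hi2 b]
  exact Finset.sum_congr rfl fun b _ => (hκ (n + 1)).integral_mul hpc (hLc b) (hgc b)

end Factor

/-! ### Continuous sections of the factor map -/

section Sections

variable {A B : ℕ → Type*} {π : ∀ i, A i → B i}

theorem exists_section_symbolicMap [∀ i, TopologicalSpace (A i)] [∀ i, TopologicalSpace (B i)]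
    [∀ i, DiscreteTopology (B i)] (hπ : ∀ i, Function.Surjective (π i)) :
    ∃ σ : (∀ i, B i) → ∀ i, A i, Continuous σ ∧ ∀ y, symbolicMap π (σ y) = y :=
  ⟨fun y i => Function.surjInv (hπ i) (y i),
    continuous_pi fun i => (continuous_of_discreteTopology (f := Function.surjInv (hπ i))).comp
      (continuous_apply i),
    fun _ => funext fun i => Function.surjInv_eq (hπ i) _⟩

theorem exists_section_tail [∀ i, Nonempty (A i)] [∀ i, TopologicalSpace (A i)]
    [∀ i, TopologicalSpace (B i)] [∀ i, DiscreteTopology (B i)]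
    (hπ : ∀ i, Function.Surjective (π i)) (n : ℕ) :
    ∃ σ : (∀ i : Set.Ici n, B i) → ∀ i, A i, Continuous σ ∧
      ∀ t, tail n (symbolicMap π (σ t)) = t := by
  refine ⟨fun t i => if h : n ≤ i then Function.surjInv (hπ i) (t ⟨i, h⟩)
    else Classical.arbitrary (A i), continuous_pi fun i => ?_, fun t => funext fun ⟨i, hi⟩ => ?_⟩
  · by_cases h : n ≤ i
    · have hc : Continuous (Function.surjInv (hπ i)) := continuous_of_discreteTopology
      simp only [h, dif_pos]
      exact hc.comp (continuous_apply (A := fun i : Set.Ici n => B i) ⟨i, h⟩)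
    · simp only [h, dif_neg, not_false_eq_true]
      exact continuous_const
  · have hi' : n ≤ i := hi
    simp only [tail, Set.domRestrict, symbolicMap, hi', dif_pos]
    exact Function.surjInv_eq (hπ i) _

/-- The symbols in the coordinate `i` that have the same image under `π i` are equivalent if
`n ≤ i`; all symbols are equivalent if `i < n`. -/
def tailSetoid (π : ∀ i, A i → B i) (n i : ℕ) : Setoid (A i) where
  r a a' := n ≤ i → π i a = π i a'
  iseqv := ⟨fun _ _ => rfl, fun h hi => (h hi).symm, fun h h' hi => (h hi).trans (h' hi)⟩

theorem tail_symbolicMap_eq_iff (n : ℕ) (x x' : ∀ i, A i) :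
    tail n (symbolicMap π x) = tail n (symbolicMap π x')
      ↔ ∀ i, tailSetoid π n i (x i) (x' i) :=
  ⟨fun h i hi => congrFun h ⟨i, hi⟩, fun h => funext fun ⟨i, hi⟩ => h i hi⟩

end Sections

end SymbolicFactor

theorem theorem2 {A B : ℕ → Type*}
    [∀ i, Fintype (A i)] [∀ i, Nonempty (A i)] [∀ i, TopologicalSpace (A i)]
    [∀ i, DiscreteTopology (A i)] [∀ i, MeasurableSpace (A i)] [∀ i, BorelSpace (A i)]
    [∀ i, Fintype (B i)] [∀ i, DecidableEq (B i)] [∀ i, TopologicalSpace (B i)]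
    [∀ i, DiscreteTopology (B i)] [∀ i, MeasurableSpace (B i)] [∀ i, BorelSpace (B i)]
    (φ : ℕ → (∀ i, A i) → ℝ) (hφ : SymbolicFactor.IsOnePointPotential φ)
    (hBerbee : SymbolicFactor.BerbeeCondition φ)
    (μ : Measure (∀ i, A i)) [IsProbabilityMeasure μ] (hμ : SymbolicFactor.IsGibbs φ μ)
    (π : ∀ i, A i → B i) (hπ : ∀ i, Function.Surjective (π i)) :
    (∃! κ : (∀ i, B i) → ProbabilityMeasure (∀ i, A i),
      SymbolicFactor.IsContinuousCondLaw μ (SymbolicFactor.symbolicMap π) κ) ∧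
    (SymbolicFactor.IsNormalised φ →
      (∀ n : ℕ, ∃! κ : (∀ i : Set.Ici n, B i) → ProbabilityMeasure (∀ i, A i),
        SymbolicFactor.IsContinuousCondLaw μ
          (fun x => SymbolicFactor.tail n (SymbolicFactor.symbolicMap π x)) κ) ∧
      ∀ κ : ∀ n : ℕ, (∀ i : Set.Ici n, B i) → ProbabilityMeasure (∀ i, A i),
        (∀ n, SymbolicFactor.IsContinuousCondLaw μ
          (fun x => SymbolicFactor.tail n (SymbolicFactor.symbolicMap π x)) (κ n)) →
        (∀ n y, 0 < SymbolicFactor.factorDensity φ π κ n y) ∧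
        SymbolicFactor.IsOnePointPotential
          (fun n y => Real.log (SymbolicFactor.factorDensity φ π κ n y)) ∧
        SymbolicFactor.IsNormalised
          (fun n y => Real.log (SymbolicFactor.factorDensity φ π κ n y)) ∧
        SymbolicFactor.IsGibbs
          (fun n y => Real.log (SymbolicFactor.factorDensity φ π κ n y))
          (μ.map (SymbolicFactor.symbolicMap π))) := by
  have hr := hBerbee.berbeeBound
  have hS := SymbolicFactor.continuous_symbolicMap π
  refine ⟨?_, fun hn => ⟨fun n => ?_, fun κ hκ => ?_⟩⟩
  · obtain ⟨σ, hσ, hσ'⟩ := SymbolicFactor.exists_section_symbolicMap hπ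
    refine SymbolicFactor.existsUnique_isContinuousCondLaw (s := fun i => Setoid.ker (π i)) hr hφ hμ
      hS hσ hσ' fun x x' => ?_
    exact funext_iff
  · obtain ⟨σ, hσ, hσ'⟩ := SymbolicFactor.exists_section_tail hπ n
    exact SymbolicFactor.existsUnique_isContinuousCondLaw hr hφ hμ
      ((SymbolicFactor.continuous_tail n).comp hS) hσ hσ'
      (SymbolicFactor.tail_symbolicMap_eq_iff n)
  · exact ⟨fun n y => SymbolicFactor.factorDensity_pos hφ.continuous hπ n y,
      SymbolicFactor.isOnePointPotential_log_factorDensity hφ.continuous hπ fun n => (hκ n).1,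
      SymbolicFactor.isNormalised_log_factorDensity hφ.continuous hn hπ,
      SymbolicFactor.isGibbs_log_factorDensity hφ hn hπ hμ hκ⟩
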